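/- Let $k$ be a commutative ring and $d,m,n\ge 0$ integers. Let $\Gamma^dP_k$ be the category whose objects are the finitely generated projective $k$-modules, with $\mathrm{Hom}(V,W)=\Gamma^d(\mathrm{Hom}_k(V,W))$, where $\Gamma^d(M)=(M^{\otimes d})^{S_d}$, and composition induced by composition of linear maps in each tensor factor. Let $\mathrm{Rep}\,\Gamma^d_k$ be the category of strict polynomial functors of degree $d$, i.e. of $k$-linear functors $\Gamma^dP_k\to k\text{-Mod}$. The internal tensor product $X\,\underline{\otimes}\,Y$ of two such functors is the Day convolution $$(X\,\underline{\otimes}\,Y)(U)=\int^{V,W}\mathrm{Hom}_{\Gamma^dP_k}(V\otimes W,U)\otimes_k X(V)\otimes_k Y(W),$$ a $k$-linear coend over $\Gamma^dP_k$. Let $\Lambda(n,d)$ be the set of sequences of $n$ non-negative integers with sum $d$. For $\lambda=(\lambda_1,\dots,\lambda_n)\in\Lambda(n,d)$ put $\Gamma^\lambda=\Gamma^{\lambda_1}\otimes\cdots\otimes\Gamma^{\lambda_n}$, $\mathrm{Sym}^\lambda=\mathrm{Sym}^{\lambda_1}\otimes\cdots\otimes\mathrm{Sym}^{\lambda_n}$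 and $\wedge^\lambda=\wedge^{\lambda_1}\otimes\cdots\otimes\wedge^{\lambda_n}$ (tensor products of divided, symmetric and exterior powers) in $\mathrm{Rep}\,\Gamma^d_k$, and let $M^\lambda=k[S_d/S_\lambda]$ be the permutation module of the Young subgroup $S_\lambda\subseteq S_d$. Let $\lambda\in\Lambda(m,d)$ and $\mu\in\Lambda(n,d)$, and let $S$ be the set of $n\times m$ matrices with non-negative integer entries, row sums $\mu$ and column sums $\lambda$; listing the entries row by row, each element of $S$ gives some $\nu\in\Lambda(mn,d)$. Then in $\mathrm{Rep}\,\Gamma^d_k$ $$\Gamma^\lambda\,\underline{\otimes}\,\wedge^\mu\simeq\bigoplus_{\nu\in S}\wedge^\nu,\qquad \Gamma^\lambda\,\underline{\otimes}\,\mathrm{Sym}^\mu\simeq\wedge^\lambda\,\underline{\otimes}\,\wedge^\mu\simeq\mathrm{Sym}^\lambda\,\underline{\otimes}\,\mathrm{Sym}^\mu\simeq\bigoplus_{\nu\in S}\mathrm{Sym}^\nu,$$ $$\mathrm{Sym}^\lambda\,\underline{\otimes}\,\wedge^\mu\simeq\bigoplus_{\nu\in S}\wedge^\nu\ \text{ if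 $2$ is a unit in $k$},\qquad \mathrm{Sym}^\lambda\,\underline{\otimes}\,\wedge^\mu\simeq\bigoplus_{\nu\in S}\mathrm{Sym}^\nu\ \text{ if $2=0$ in $k$}.$$ Moreover, $M^\mu\otimes_k M^\lambda\simeq\bigoplus_{\nu\in S}M^\nu$ as $kS_d$-modules, with $S_d$ acting diagonally on the left-hand side. -/

import Mathlib

open CategoryTheory
open scoped TensorProduct

universe u

namespace StrictPoly

noncomputable section

/-! ## Tensor powers with their symmetric group action, and divided powers -/

/-- The tensor power `M^{⊗ d}`. -/
abbrev TPow (k : Type u) [CommRing k] (d : ℕ) (M : Type u) [AddCommGroup M] [Module k M] : Type u :=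
  PiTensorProduct k (fun _ : Fin d => M)

/-- The place permutation action of the symmetric group on `M^{⊗ d}`:
`σ • (x₁ ⊗ ⋯ ⊗ x_d)` has the factor `x_{σ⁻¹ i}` in the place `i`. -/
def perm (k : Type u) [CommRing k] {d : ℕ} {M : Type u} [AddCommGroup M] [Module k M]
    (σ : Equiv.Perm (Fin d)) : TPow k d M →ₗ[k] TPow k d M :=
  (PiTensorProduct.reindex k (fun _ : Fin d => M) σ).toLinearMap

/-- The tensors invariant under a subgroup `G` of the symmetric group. -/
def invariants (k : Type u) [CommRing k] {d : ℕ} (G : Subgroup (Equiv.Perm (Fin d)))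
    (M : Type u) [AddCommGroup M] [Module k M] : Submodule k (TPow k d M) where
  carrier := {t | ∀ σ ∈ G, perm k σ t = t}
  add_mem' ha hb σ hσ := by rw [map_add, ha σ hσ, hb σ hσ]
  zero_mem' σ _ := map_zero _
  smul_mem' c t ht σ hσ := by rw [map_smul, ht σ hσ]

/-- The divided power `Γ^d(M) = (M^{⊗ d})^{S_d}`. -/
abbrev DPow (k : Type u) [CommRing k] (d : ℕ) (M : Type u) [AddCommGroup M] [Module k M] :
    Submodule k (TPow k d M) :=
  invariants k ⊤ M

section Lemmas

variable {k : Type u} [CommRing k] {d : ℕ}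
variable {M N P Q : Type u} [AddCommGroup M] [Module k M] [AddCommGroup N] [Module k N]
  [AddCommGroup P] [Module k P] [AddCommGroup Q] [Module k Q]

@[simp] lemma perm_tprod (σ : Equiv.Perm (Fin d)) (x : Fin d → M) :
    perm k σ (PiTensorProduct.tprod k x) = PiTensorProduct.tprod k (fun i => x (σ.symm i)) :=
  PiTensorProduct.reindex_tprod σ x

/-- The bilinear map `M^{⊗ d} × N^{⊗ d} → P^{⊗ d}` given by a bilinear map `M × N → P` in every
place. -/
def place₂ (d : ℕ) (b : M →ₗ[k] N →ₗ[k] P) : TPow k d M →ₗ[k] TPow k d N →ₗ[k] TPow k d P :=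
  PiTensorProduct.map₂ (fun _ => b)

@[simp] lemma place₂_tprod (b : M →ₗ[k] N →ₗ[k] P) (x : Fin d → M) (y : Fin d → N) :
    place₂ d b (PiTensorProduct.tprod k x) (PiTensorProduct.tprod k y) =
      PiTensorProduct.tprod k (fun i => b (x i) (y i)) :=
  PiTensorProduct.map₂_tprod_tprod _ _ _

lemma tpow_induction {p : TPow k d M → Prop} (t : TPow k d M)
    (h : ∀ x : Fin d → M, p (PiTensorProduct.tprod k x))
    (hs : ∀ (c : k) t, p t → p (c • t)) (ha : ∀ s t, p s → p t → p (s + t)) : p t := by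
  induction t using PiTensorProduct.induction_on with
  | smul_tprod r x => exact hs _ _ (h x)
  | add s t h₁ h₂ => exact ha _ _ h₁ h₂

lemma perm_place₂ (σ : Equiv.Perm (Fin d)) (b : M →ₗ[k] N →ₗ[k] P) (s : TPow k d M)
    (t : TPow k d N) : perm k σ (place₂ d b s t) = place₂ d b (perm k σ s) (perm k σ t) := by
  induction s using tpow_induction with
  | h x =>
    induction t using tpow_induction with
    | h y => simp
    | hs c t h => simp [h]
    | ha s t h₁ h₂ => simp [h₁, h₂]
  | hs c t h => simp [h]
  | ha s t h₁ h₂ => simp [h₁, h₂]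

lemma place₂_mem (b : M →ₗ[k] N →ₗ[k] P) {G : Subgroup (Equiv.Perm (Fin d))} {s : TPow k d M}
    {t : TPow k d N} (hs : s ∈ invariants k G M) (ht : t ∈ invariants k G N) :
    place₂ d b s t ∈ invariants k G P := fun σ hσ => by
  rw [perm_place₂, hs σ hσ, ht σ hσ]

lemma diag_mem (x : M) : PiTensorProduct.tprod k (fun _ : Fin d => x) ∈ DPow k d M :=
  fun σ _ => by simp

/-- Composition `Hom(N, P)^{⊗ d} × Hom(M, N)^{⊗ d} → Hom(M, P)^{⊗ d}`, place by place. -/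
def compT : TPow k d (N →ₗ[k] P) →ₗ[k] TPow k d (M →ₗ[k] N) →ₗ[k] TPow k d (M →ₗ[k] P) :=
  place₂ d (LinearMap.llcomp k M N P)

/-- The action `Hom(M, N)^{⊗ d} × M^{⊗ d} → N^{⊗ d}`, place by place. -/
def actT : TPow k d (M →ₗ[k] N) →ₗ[k] TPow k d M →ₗ[k] TPow k d N :=
  place₂ d LinearMap.id

/-- The tensor product `Hom(M, N)^{⊗ d} × Hom(P, Q)^{⊗ d} → Hom(M ⊗ P, N ⊗ Q)^{⊗ d}`, place by
place. -/
def tensT : TPow k d (M →ₗ[k] N) →ₗ[k] TPow k d (P →ₗ[k] Q) →ₗ[k]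
    TPow k d ((M ⊗[k] P) →ₗ[k] (N ⊗[k] Q)) :=
  place₂ d (LinearMap.mk₂ k TensorProduct.map TensorProduct.map_add_left
    TensorProduct.map_smul_left TensorProduct.map_add_right TensorProduct.map_smul_right)

@[simp] lemma compT_tprod (f : Fin d → N →ₗ[k] P) (g : Fin d → M →ₗ[k] N) :
    compT (PiTensorProduct.tprod k f) (PiTensorProduct.tprod k g) =
      PiTensorProduct.tprod k (fun i => f i ∘ₗ g i) := place₂_tprod _ _ _

@[simp] lemma actT_tprod (f : Fin d → M →ₗ[k] N) (x : Fin d → M) :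
    actT (PiTensorProduct.tprod k f) (PiTensorProduct.tprod k x) =
      PiTensorProduct.tprod k (fun i => f i (x i)) := place₂_tprod _ _ _

@[simp] lemma tensT_tprod (f : Fin d → M →ₗ[k] N) (g : Fin d → P →ₗ[k] Q) :
    tensT (PiTensorProduct.tprod k f) (PiTensorProduct.tprod k g) =
      PiTensorProduct.tprod k (fun i => TensorProduct.map (f i) (g i)) := place₂_tprod _ _ _

/-- The identity of `M`, in every place. -/
def idT (k : Type u) [CommRing k] (d : ℕ) (M : Type u) [AddCommGroup M] [Module k M] :
    TPow k d (M →ₗ[k] M) :=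
  PiTensorProduct.tprod k (fun _ => LinearMap.id)

lemma compT_idT (f : TPow k d (M →ₗ[k] N)) : compT f (idT k d M) = f := by
  induction f using tpow_induction with
  | h x => simp [idT]
  | hs c t h => simp [h]
  | ha s t h₁ h₂ => simp [h₁, h₂]

lemma idT_compT (f : TPow k d (M →ₗ[k] N)) : compT (idT k d N) f = f := by
  induction f using tpow_induction with
  | h x => simp [idT]
  | hs c t h => simp [h]
  | ha s t h₁ h₂ => simp [h₁, h₂]

lemma compT_assoc (h : TPow k d (P →ₗ[k] Q)) (g : TPow k d (N →ₗ[k] P))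
    (f : TPow k d (M →ₗ[k] N)) : compT (compT h g) f = compT h (compT g f) := by
  induction h using tpow_induction with
  | h x =>
    induction g using tpow_induction with
    | h y =>
      induction f using tpow_induction with
      | h z => simp [LinearMap.comp_assoc]
      | hs c t h => simp only [map_smul, h]
      | ha s t h₁ h₂ => simp only [map_add, h₁, h₂]
    | hs c t h => simp only [map_smul, LinearMap.smul_apply, h]
    | ha s t h₁ h₂ => simp only [map_add, LinearMap.add_apply, h₁, h₂]
  | hs c t h => simp only [map_smul, LinearMap.smul_apply, h]
  | ha s t h₁ h₂ => simp only [map_add, LinearMap.add_apply, h₁, h₂]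

lemma actT_idT (t : TPow k d M) : actT (idT k d M) t = t := by
  induction t using tpow_induction with
  | h x => simp [idT]
  | hs c t h => simp [h]
  | ha s t h₁ h₂ => simp [h₁, h₂]

lemma actT_compT (g : TPow k d (N →ₗ[k] P)) (f : TPow k d (M →ₗ[k] N)) (t : TPow k d M) :
    actT (compT g f) t = actT g (actT f t) := by
  induction g using tpow_induction with
  | h x =>
    induction f using tpow_induction with
    | h y =>
      induction t using tpow_induction with
      | h z => simp
      | hs c t h => simp only [map_smul, h]
      | ha s t h₁ h₂ => simp only [map_add, h₁, h₂]
    | hs c t h => simp only [map_smul, LinearMap.smul_apply, h]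
    | ha s t h₁ h₂ => simp only [map_add, LinearMap.add_apply, h₁, h₂]
  | hs c t h => simp only [map_smul, LinearMap.smul_apply, h]
  | ha s t h₁ h₂ => simp only [map_add, LinearMap.add_apply, h₁, h₂]

lemma perm_actT {f : TPow k d (M →ₗ[k] N)} (hf : f ∈ DPow k d (M →ₗ[k] N))
    (σ : Equiv.Perm (Fin d)) (t : TPow k d M) :
    perm k σ (actT f t) = actT f (perm k σ t) := by
  rw [actT, perm_place₂, hf σ trivial]

end Lemmas

/-! ## The divided power category -/

/-- Objects of the divided power category `Γ^d P_k`: finitely generated projective `k`-modules. -/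
structure DivCat (k : Type u) [CommRing k] (d : ℕ) : Type (u + 1) where
  carrier : Type u
  [addCommGroup : AddCommGroup carrier]
  [module : Module k carrier]
  [finite : Module.Finite k carrier]
  [projective : Module.Projective k carrier]

attribute [instance] DivCat.addCommGroup DivCat.module DivCat.finite DivCat.projective

variable {k : Type u} [CommRing k] {d : ℕ}

/-- `Γ^d P_k`: the morphisms are `Hom(V, W) = Γ^d(Hom_k(V, W))`, composed place by place. -/
instance : Category.{u} (DivCat k d) where
  Hom V W := DPow k d (V.carrier →ₗ[k] W.carrier)
  id V := ⟨idT k d V.carrier, diag_mem _⟩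
  comp f g := ⟨compT g.1 f.1, place₂_mem _ g.2 f.2⟩
  id_comp f := Subtype.ext (compT_idT f.1)
  comp_id f := Subtype.ext (idT_compT f.1)
  assoc f g h := Subtype.ext (compT_assoc h.1 g.1 f.1).symm

instance : Preadditive (DivCat k d) where
  homGroup V W := inferInstanceAs (AddCommGroup (DPow k d (V.carrier →ₗ[k] W.carrier)))
  add_comp _ _ _ f f' g := Subtype.ext (map_add (compT g.1) f.1 f'.1)
  comp_add _ _ _ f g g' := Subtype.ext (LinearMap.map_add₂ compT g.1 g'.1 f.1)

instance : Linear k (DivCat k d) where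
  homModule V W := inferInstanceAs (Module k (DPow k d (V.carrier →ₗ[k] W.carrier)))
  smul_comp _ _ _ r f g := Subtype.ext (map_smul (compT g.1) r f.1)
  comp_smul _ _ _ f r g := Subtype.ext (LinearMap.map_smul₂ compT r g.1 f.1)

namespace DivCat

/-- The underlying element of `Hom_k(V, W)^{⊗ d}` of a morphism. -/
def val {V W : DivCat k d} : (V ⟶ W) →ₗ[k] TPow k d (V.carrier →ₗ[k] W.carrier) :=
  (DPow k d (V.carrier →ₗ[k] W.carrier)).subtype

lemma val_mem {V W : DivCat k d} (f : V ⟶ W) :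
    val f ∈ DPow k d (V.carrier →ₗ[k] W.carrier) := f.2

lemma val_injective {V W : DivCat k d} {f g : V ⟶ W} (h : val f = val g) : f = g := Subtype.ext h

@[simp] lemma val_id (V : DivCat k d) : val (𝟙 V) = idT k d V.carrier := rfl

@[simp] lemma val_comp {U V W : DivCat k d} (f : U ⟶ V) (g : V ⟶ W) :
    val (f ≫ g) = compT (val g) (val f) := rfl

/-- The morphism `f ⊗ ⋯ ⊗ f` given by a linear map `f`. -/
def diag {V W : DivCat k d} (f : V.carrier →ₗ[k] W.carrier) : V ⟶ W :=
  ⟨PiTensorProduct.tprod k (fun _ => f), diag_mem f⟩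

/-- The tensor product of `Γ^d P_k` on objects. -/
def tensor (V W : DivCat k d) : DivCat k d where
  carrier := V.carrier ⊗[k] W.carrier

/-- The tensor product of `Γ^d P_k` on morphisms. -/
def tensorHom {V V' W W' : DivCat k d} (f : V ⟶ V') (g : W ⟶ W') :
    V.tensor W ⟶ V'.tensor W' :=
  ⟨tensT (val f) (val g), place₂_mem _ f.2 g.2⟩

/-- The free module `k^n`. -/
def free (k : Type u) [CommRing k] (d n : ℕ) : DivCat k d where
  carrier := Fin n → k

lemma exists_retract (V : DivCat k d) :
    ∃ (n : ℕ) (i : V ⟶ free k d n) (p : free k d n ⟶ V), i ≫ p = 𝟙 V := by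
  obtain ⟨n, f, g, -, -, h⟩ := Module.Finite.exists_comp_eq_id_of_projective k V.carrier
  refine ⟨n, diag (W := free k d n) g, diag (V := free k d n) f, val_injective ?_⟩
  change compT (PiTensorProduct.tprod k (fun _ : Fin d => f))
    (PiTensorProduct.tprod k (fun _ => g)) = _
  rw [compT_tprod, h]
  rfl

end DivCat

/-! ## Strict polynomial functors -/

/-- The category `Rep Γ^d_k` of strict polynomial functors of degree `d`: the `k`-linear functors
from `Γ^d P_k` to `k`-modules, with all natural transformations. -/
abbrev SPF (k : Type u) [CommRing k] (d : ℕ) :=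
  ObjectProperty.FullSubcategory
    (fun F : DivCat k d ⥤ ModuleCat.{u} k => F.Additive ∧ F.Linear k)

/-- A strict polynomial functor from its values and its linear action on morphisms. -/
def SPF.of (obj : DivCat k d → Type u) [∀ V, AddCommGroup (obj V)] [∀ V, Module k (obj V)]
    (map : ∀ {V W : DivCat k d}, (V ⟶ W) →ₗ[k] (obj V →ₗ[k] obj W))
    (map_id : ∀ (V : DivCat k d) (x : obj V), map (𝟙 V) x = x)
    (map_comp : ∀ {U V W : DivCat k d} (f : U ⟶ V) (g : V ⟶ W) (x : obj U),
      map (f ≫ g) x = map g (map f x)) : SPF k d where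
  obj :=
    { obj := fun V => ModuleCat.of k (obj V)
      map := fun f => ModuleCat.ofHom (map f)
      map_id := fun V => by ext x; exact map_id V x
      map_comp := fun f g => by ext x; exact map_comp f g x }
  property := ⟨⟨fun {V W f g} => by ext x; exact LinearMap.congr_fun (map_add map f g) x⟩,
    ⟨fun f r => by ext x; exact LinearMap.congr_fun (map_smul map r f) x⟩⟩

namespace SPF

/-- The value `X(V)`. -/
abbrev val (X : SPF k d) (V : DivCat k d) : Type u := X.obj.obj V

/-- The action of a morphism of `Γ^d P_k`. -/
abbrev act (X : SPF k d) {V W : DivCat k d} (f : V ⟶ W) : X.val V →ₗ[k] X.val W :=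
  (X.obj.map f).hom

/-- The action on morphisms, as a linear map. -/
def actₗ (X : SPF k d) {V W : DivCat k d} : (V ⟶ W) →ₗ[k] (X.val V →ₗ[k] X.val W) where
  toFun f := X.act f
  map_add' f g := by
    have := X.property.1
    simp [act, Functor.map_add]
  map_smul' r f := by
    have := X.property.2
    simp [act, Functor.map_smul]

lemma act_id (X : SPF k d) (V : DivCat k d) (x : X.val V) : X.act (𝟙 V) x = x := by
  simp [act]

lemma act_comp (X : SPF k d) {U V W : DivCat k d} (f : U ⟶ V) (g : V ⟶ W) (x : X.val U) :
    X.act (f ≫ g) x = X.act g (X.act f x) := by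
  simp [act]

/-- The direct sum of a family of strict polynomial functors, computed pointwise. -/
def directSum {ι : Type} (X : ι → SPF k d) : SPF k d :=
  SPF.of (fun V => DirectSum ι fun i => (X i).val V)
    (fun {V W} =>
      { toFun := fun f => DirectSum.lmap fun i => (X i).actₗ f
        map_add' := fun f g => by
          classical
          refine DirectSum.linearMap_ext k fun i => ?_
          ext x : 1
          simp [DirectSum.lmap_lof]
        map_smul' := fun r f => by
          classical
          refine DirectSum.linearMap_ext k fun i => ?_
          ext x : 1
          simp [DirectSum.lmap_lof] })
    (fun V x => by
      have : DirectSum.lmap (fun i => (X i).act (𝟙 V)) = LinearMap.id := by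
        ext i x : 2
        simp [act_id]
      exact LinearMap.congr_fun this x)
    (fun {U V W} f g x => by
      have : DirectSum.lmap (fun i => (X i).act (f ≫ g)) =
          DirectSum.lmap (fun i => (X i).act g) ∘ₗ DirectSum.lmap (fun i => (X i).act f) := by
        ext i x : 2
        simp [act_comp]
      exact LinearMap.congr_fun this x)

/-! ### The internal tensor product -/

/-- The summands `Hom(V ⊗ W, U) ⊗ X(V) ⊗ Y(W)` of the coend, for all `V`, `W` in `Γ^d P_k`. -/
abbrev CoendSum (X Y : SPF k d) (U : DivCat k d) : Type (u + 1) :=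
  DirectSum (DivCat k d × DivCat k d) fun p =>
    (p.1.tensor p.2 ⟶ U) ⊗[k] (X.val p.1 ⊗[k] Y.val p.2)

/-- The element `φ ⊗ x ⊗ y` of the summand of `V`, `W`. -/
def coendι (X Y : SPF k d) {U : DivCat k d} (V W : DivCat k d) (φ : V.tensor W ⟶ U)
    (x : X.val V) (y : Y.val W) : CoendSum X Y U :=
  open scoped Classical in
  DirectSum.lof k (DivCat k d × DivCat k d)
    (fun p => (p.1.tensor p.2 ⟶ U) ⊗[k] (X.val p.1 ⊗[k] Y.val p.2)) (V, W) (φ ⊗ₜ (x ⊗ₜ y))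

/-- The relations `(φ ∘ (g ⊗ h)) ⊗ x ⊗ y ∼ φ ⊗ X(g)(x) ⊗ Y(h)(y)` of the coend. -/
def coendRel (X Y : SPF k d) (U : DivCat k d) : Submodule k (CoendSum X Y U) :=
  Submodule.span k {t | ∃ (V V' W W' : DivCat k d) (g : V ⟶ V') (h : W ⟶ W')
    (φ : V'.tensor W' ⟶ U) (x : X.val V) (y : Y.val W),
    t = coendι X Y V W (DivCat.tensorHom g h ≫ φ) x y -
      coendι X Y V' W' φ (X.act g x) (Y.act h y)}

/-- The coend `∫^{V, W} Hom(V ⊗ W, U) ⊗ X(V) ⊗ Y(W)` over `Γ^d P_k`. -/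
abbrev Coend (X Y : SPF k d) (U : DivCat k d) : Type (u + 1) := CoendSum X Y U ⧸ coendRel X Y U

lemma coendSum_hom_ext {X Y : SPF k d} {U : DivCat k d} {M : Type*} [AddCommGroup M] [Module k M]
    {f g : CoendSum X Y U →ₗ[k] M}
    (h : ∀ V W φ x y, f (coendι X Y V W φ x y) = g (coendι X Y V W φ x y)) : f = g := by
  classical
  refine DirectSum.linearMap_ext k fun p => ?_
  refine TensorProduct.ext' fun φ z => ?_
  induction z using TensorProduct.induction_on with
  | zero => simp
  | tmul x y =>
    have := h p.1 p.2 φ x y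
    simpa only [coendι, LinearMap.comp_apply, Subsingleton.elim (Classical.decEq _)] using this
  | add a b ha hb => rw [TensorProduct.tmul_add, map_add, map_add, ha, hb]

lemma coend_hom_ext {X Y : SPF k d} {U : DivCat k d} {M : Type*} [AddCommGroup M] [Module k M]
    {f g : Coend X Y U →ₗ[k] M}
    (h : ∀ V W φ x y, f ((coendRel X Y U).mkQ (coendι X Y V W φ x y)) =
      g ((coendRel X Y U).mkQ (coendι X Y V W φ x y))) : f = g :=
  Submodule.linearMap_qext _ (coendSum_hom_ext h)

/-- Postcomposition with `ψ` on every summand. -/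
def coendSumMap (X Y : SPF k d) {U U' : DivCat k d} (ψ : U ⟶ U') :
    CoendSum X Y U →ₗ[k] CoendSum X Y U' :=
  DirectSum.lmap fun p =>
    LinearMap.rTensor (X.val p.1 ⊗[k] Y.val p.2) (Linear.rightComp k (p.1.tensor p.2) ψ)

lemma coendSumMap_ι (X Y : SPF k d) {U U' : DivCat k d} (ψ : U ⟶ U') (V W : DivCat k d)
    (φ : V.tensor W ⟶ U) (x : X.val V) (y : Y.val W) :
    coendSumMap X Y ψ (coendι X Y V W φ x y) = coendι X Y V W (φ ≫ ψ) x y := by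
  classical
  simp [coendSumMap, coendι, DirectSum.lmap_lof]

/-- The action of `ψ` on the coend. -/
def coendMap (X Y : SPF k d) {U U' : DivCat k d} (ψ : U ⟶ U') :
    Coend X Y U →ₗ[k] Coend X Y U' :=
  Submodule.mapQ _ _ (coendSumMap X Y ψ) <| Submodule.span_le.2 <| by
    rintro _ ⟨V, V', W, W', g, h, φ, x, y, rfl⟩
    refine Submodule.subset_span ⟨V, V', W, W', g, h, φ ≫ ψ, x, y, ?_⟩
    rw [map_sub, coendSumMap_ι, coendSumMap_ι, Category.assoc]

lemma coendMap_ι (X Y : SPF k d) {U U' : DivCat k d} (ψ : U ⟶ U') (V W : DivCat k d)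
    (φ : V.tensor W ⟶ U) (x : X.val V) (y : Y.val W) :
    coendMap X Y ψ ((coendRel X Y U).mkQ (coendι X Y V W φ x y)) =
      (coendRel X Y U').mkQ (coendι X Y V W (φ ≫ ψ) x y) := by
  rw [← coendSumMap_ι]
  rfl

/-- The coend is already generated by the summands of the free modules `k^m`, `k^n`, so it is not
larger than a `k`-module in `Rep Γ^d_k`. -/
instance (X Y : SPF k d) (U : DivCat k d) : Small.{u} (Coend X Y U) := by
  classical
  let F : ℕ → DivCat k d := DivCat.free k d
  let T : ℕ × ℕ → Type u := fun q =>
    ((F q.1).tensor (F q.2) ⟶ U) ⊗[k] (X.val (F q.1) ⊗[k] Y.val (F q.2))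
  let j : DirectSum (ℕ × ℕ) T →ₗ[k] CoendSum X Y U :=
    DirectSum.toModule k _ _ fun q => DirectSum.lof k (DivCat k d × DivCat k d)
      (fun p => (p.1.tensor p.2 ⟶ U) ⊗[k] (X.val p.1 ⊗[k] Y.val p.2)) (F q.1, F q.2)
  have hj : ∀ m n φ x y, j (DirectSum.lof k _ T (m, n) (φ ⊗ₜ (x ⊗ₜ y))) =
      coendι X Y (F m) (F n) φ x y := fun m n φ x y => by
    refine (DirectSum.toModule_lof k (m, n) _).trans ?_
    simp only [coendι]
  let π : DirectSum (ℕ × ℕ) T →ₗ[k] Coend X Y U := (coendRel X Y U).mkQ ∘ₗ j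
  suffices h : LinearMap.range π = ⊤ from small_of_surjective (LinearMap.range_eq_top.1 h)
  have h0 : (LinearMap.range π).mkQ = 0 := by
    refine coend_hom_ext fun V W φ x y => ?_
    obtain ⟨m, i, p, hip⟩ := V.exists_retract
    obtain ⟨n, i', p', hip'⟩ := W.exists_retract
    have key : (coendRel X Y U).mkQ (coendι X Y V W φ x y) =
        π (DirectSum.lof k _ T (m, n)
          ((DivCat.tensorHom p p' ≫ φ) ⊗ₜ (X.act i x ⊗ₜ Y.act i' y))) := by
      change _ = (coendRel X Y U).mkQ (j _)
      rw [hj, eq_comm, ← sub_eq_zero, ← map_sub, Submodule.mkQ_apply,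
        Submodule.Quotient.mk_eq_zero]
      refine Submodule.subset_span ⟨_, _, _, _, p, p', φ, X.act i x, Y.act i' y, ?_⟩
      rw [← act_comp, ← act_comp, hip, hip', act_id, act_id]
    rw [key, LinearMap.zero_apply, Submodule.mkQ_apply, Submodule.Quotient.mk_eq_zero]
    exact LinearMap.mem_range_self _ _
  rw [← Submodule.ker_mkQ (LinearMap.range π), h0, LinearMap.ker_zero]

/-- A copy of the coend in the universe of `k`. -/
def CoendSmall (X Y : SPF k d) (U : DivCat k d) : Type u := Shrink.{u} (Coend X Y U)

instance (X Y : SPF k d) (U : DivCat k d) : AddCommGroup (CoendSmall X Y U) :=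
  inferInstanceAs (AddCommGroup (Shrink.{u} (Coend X Y U)))

instance (X Y : SPF k d) (U : DivCat k d) : Module k (CoendSmall X Y U) where
  __ := (inferInstance : Module k (Shrink.{u} (Coend X Y U)))

/-- The copy is linearly equivalent to the coend. -/
def coendEquiv (X Y : SPF k d) (U : DivCat k d) : CoendSmall X Y U ≃ₗ[k] Coend X Y U where
  __ := Shrink.linearEquiv.{u} k (Coend X Y U)

/-- The internal tensor product `X ⊗ Y` (Day convolution along the tensor product of `Γ^d P_k`):
the strict polynomial functor `U ↦ ∫^{V, W} Hom(V ⊗ W, U) ⊗ X(V) ⊗ Y(W)`. Since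
`Hom(V ⊗ W, -)` is the functor represented by `V ⊗ W`, this is the bifunctor that preserves colimits
in each variable and takes the functors represented by `V` and `W` to the one represented
by `V ⊗ W`. -/
def internalTensor (X Y : SPF k d) : SPF k d :=
  SPF.of (CoendSmall X Y)
    (fun {U U'} =>
      { toFun := fun ψ => (coendEquiv X Y U').symm.toLinearMap ∘ₗ
          coendMap X Y ψ ∘ₗ (coendEquiv X Y U).toLinearMap
        map_add' := fun ψ ψ' => by
          have : coendMap X Y (ψ + ψ') = coendMap X Y ψ + coendMap X Y ψ' :=
            coend_hom_ext fun V W φ x y => by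
              rw [LinearMap.add_apply, coendMap_ι, coendMap_ι, coendMap_ι, ← map_add]
              simp [coendι, TensorProduct.add_tmul]
          rw [this, LinearMap.add_comp, LinearMap.comp_add]
        map_smul' := fun r ψ => by
          have : coendMap X Y (r • ψ) = r • coendMap X Y ψ :=
            coend_hom_ext fun V W φ x y => by
              rw [LinearMap.smul_apply, coendMap_ι, coendMap_ι, ← map_smul, Linear.comp_smul,
                coendι, ← TensorProduct.smul_tmul', map_smul]
              rfl
          rw [this, LinearMap.smul_comp, LinearMap.comp_smul, RingHom.id_apply] })
    (fun U z => by
      have : coendMap X Y (𝟙 U) = LinearMap.id := coend_hom_ext fun V W φ x y => by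
        rw [coendMap_ι, Category.comp_id]
        rfl
      simp [this])
    (fun {U U' U''} ψ ψ' z => by
      have : coendMap X Y (ψ ≫ ψ') = coendMap X Y ψ' ∘ₗ coendMap X Y ψ :=
        coend_hom_ext fun V W φ x y => by
          rw [LinearMap.comp_apply, coendMap_ι, coendMap_ι, coendMap_ι, Category.assoc]
      simp [this])

end SPF

/-! ## Weights and Young subgroups -/

/-- `Λ(n, d)`: the sequences of `n` non-negative integers with sum `d`. -/
abbrev Weight (n d : ℕ) := {l : Fin n → ℕ // ∑ i, l i = d}

namespace Weight

variable {n m : ℕ}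

/-- The block that contains a place, where the `d` places are cut into consecutive blocks of
lengths `l 0, l 1, …`. -/
def block (l : Weight n d) (j : Fin d) : Fin n :=
  (finSigmaFinEquiv.symm (Fin.cast l.2.symm j)).1

/-- The Young subgroup `S_l` of the permutations that preserve every block. -/
def young (l : Weight n d) : Subgroup (Equiv.Perm (Fin d)) where
  carrier := {σ | ∀ j, l.block (σ j) = l.block j}
  mul_mem' {σ τ} hσ hτ j := by rw [Equiv.Perm.mul_apply, hσ, hτ]
  one_mem' _ := rfl
  inv_mem' {σ} hσ j := by
    rw [← hσ (σ⁻¹ j)]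
    simp

/-- The set `S` of the `n × m` matrices with non-negative integer entries, row sums `r` and column
sums `c`. -/
abbrev Matrices (r : Weight n d) (c : Weight m d) :=
  {A : Matrix (Fin n) (Fin m) ℕ // (∀ i, ∑ j, A i j = r.1 i) ∧ ∀ j, ∑ i, A i j = c.1 j}

/-- The weight in `Λ(n m, d)` that lists the entries of a matrix row by row. -/
def ofMatrix {r : Weight n d} {c : Weight m d} (A : Matrices r c) : Weight (n * m) d :=
  ⟨fun p => A.1 (finProdFinEquiv.symm p).1 (finProdFinEquiv.symm p).2, by
    rw [Equiv.sum_comp finProdFinEquiv.symm (fun q : Fin n × Fin m => A.1 q.1 q.2),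
      Fintype.sum_prod_type]
    simp only [A.2.1, r.2]⟩

end Weight

/-! ## The exponential functors

Cutting the places into blocks identifies `V^{⊗ d}` with `V^{⊗ l 0} ⊗ V^{⊗ l 1} ⊗ ⋯`. For `V`
finitely generated projective this identifies the tensor products of divided, symmetric and
exterior powers with a submodule and two quotients of `V^{⊗ d}`. The action of
`Γ^d(Hom(V, W))` is induced by its action on `V^{⊗ d}`. -/

variable {n : ℕ}

/-- `Γ^l = Γ^{l 0} ⊗ Γ^{l 1} ⊗ ⋯`, with value `(V^{⊗ d})^{S_l}` at `V`. -/
def Gam (k : Type u) [CommRing k] (l : Weight n d) : SPF k d :=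
  SPF.of (fun V => invariants k l.young V.carrier)
    (fun {V W} =>
      { toFun := fun f => (actT (DivCat.val f)).restrict fun t ht σ hσ => by
          rw [perm_actT (DivCat.val_mem f), ht σ hσ]
        map_add' := fun f g => LinearMap.ext fun t => Subtype.ext <|
          LinearMap.congr_fun ((actT.map_add _ _ : actT (DivCat.val (f + g)) = _)) t.1
        map_smul' := fun r f => LinearMap.ext fun t => Subtype.ext <|
          LinearMap.congr_fun ((actT.map_smul _ _ : actT (DivCat.val (r • f)) = _)) t.1 })
    (fun V t => Subtype.ext (actT_idT t.1))
    (fun f g t => Subtype.ext (actT_compT _ _ t.1))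

/-- The kernel of `V^{⊗ d} → Sym^{l 0}(V) ⊗ Sym^{l 1}(V) ⊗ ⋯`: the differences of a tensor and its
permutation inside the blocks. -/
def symRel (k : Type u) [CommRing k] (l : Weight n d) (M : Type u) [AddCommGroup M] [Module k M] :
    Submodule k (TPow k d M) :=
  Submodule.span k {t | ∃ σ ∈ l.young, ∃ s : TPow k d M, t = perm k σ s - s}

lemma symRel_le (l : Weight n d) {V W : DivCat k d} (f : V ⟶ W) :
    symRel k l V.carrier ≤ (symRel k l W.carrier).comap (actT (DivCat.val f)) := by
  refine Submodule.span_le.2 ?_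
  rintro _ ⟨σ, hσ, s, rfl⟩
  refine Submodule.subset_span ⟨σ, hσ, actT (DivCat.val f) s, ?_⟩
  rw [map_sub, perm_actT (DivCat.val_mem f)]

/-- `Sym^l = Sym^{l 0} ⊗ Sym^{l 1} ⊗ ⋯`, with value the coinvariants `(V^{⊗ d})_{S_l}` at `V`. -/
def Symm (k : Type u) [CommRing k] (l : Weight n d) : SPF k d :=
  SPF.of (fun V => TPow k d V.carrier ⧸ symRel k l V.carrier)
    (fun {V W} =>
      { toFun := fun f => Submodule.mapQ _ _ (actT (DivCat.val f)) (symRel_le l f)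
        map_add' := fun f g => by
          refine Submodule.linearMap_qext _ (LinearMap.ext fun t => ?_)
          simp
        map_smul' := fun r f => by
          refine Submodule.linearMap_qext _ (LinearMap.ext fun t => ?_)
          simp })
    (fun V t => by
      obtain ⟨t, rfl⟩ := Submodule.mkQ_surjective _ t
      simp [actT_idT])
    (fun f g t => by
      obtain ⟨t, rfl⟩ := Submodule.mkQ_surjective _ t
      simp [actT_compT])

/-- The kernel of `V^{⊗ d} → ∧^{l 0}(V) ⊗ ∧^{l 1}(V) ⊗ ⋯`: it is spanned by the pure tensors with
equal factors in two places of one block. -/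
def altRel (k : Type u) [CommRing k] (l : Weight n d) (M : Type u) [AddCommGroup M] [Module k M] :
    Submodule k (TPow k d M) :=
  Submodule.span k {t | ∃ (i j : Fin d) (x : Fin d → M), i ≠ j ∧ l.block i = l.block j ∧
    x i = x j ∧ t = PiTensorProduct.tprod k x}

section Alt

variable {M N : Type u} [AddCommGroup M] [Module k M] [AddCommGroup N] [Module k N]

/-- The span of the pure tensors with equal factors in the places `i` and `j`. -/
def altPair (k : Type u) [CommRing k] {d : ℕ} (i j : Fin d) (M : Type u) [AddCommGroup M]
    [Module k M] : Submodule k (TPow k d M) :=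
  Submodule.span k {t | ∃ x : Fin d → M, x i = x j ∧ t = PiTensorProduct.tprod k x}

lemma altPair_add_swap {i j : Fin d} (hij : i ≠ j) (x : Fin d → M) :
    PiTensorProduct.tprod k x + PiTensorProduct.tprod k (x ∘ Equiv.swap i j) ∈
      altPair k i j M := by
  have hx : ∀ a b : M, Function.update (Function.update x i a) j b i = a := fun a b => by
    rw [Function.update_of_ne hij, Function.update_self]
  have hy : ∀ a b : M, Function.update (Function.update x i a) j b j = b := fun a b => by
    rw [Function.update_self]
  let B : M → M → TPow k d M := fun a b =>
    PiTensorProduct.tprod k (Function.update (Function.update x i a) j b)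
  have hB : ∀ a, B a a ∈ altPair k i j M := fun a =>
    Submodule.subset_span ⟨_, by rw [hx, hy], rfl⟩
  have h₁ : ∀ a b b', B a (b + b') = B a b + B a b' := fun a b b' =>
    MultilinearMap.map_update_add _ _ _ _ _
  have h₂ : ∀ a a' b, B (a + a') b = B a b + B a' b := fun a a' b => by
    simp only [B, Function.update_comm hij]
    exact MultilinearMap.map_update_add _ _ _ _ _
  have e₁ : PiTensorProduct.tprod k x = B (x i) (x j) := by simp [B]
  have e₂ : PiTensorProduct.tprod k (x ∘ Equiv.swap i j) = B (x j) (x i) := by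
    simp only [B]
    congr 1
    ext p
    rcases eq_or_ne p i with rfl | hi
    · simp [hx]
    · rcases eq_or_ne p j with rfl | hj
      · simp
      · simp [hi, hj, Equiv.swap_apply_of_ne_of_ne]
  have e : PiTensorProduct.tprod k x + PiTensorProduct.tprod k (x ∘ Equiv.swap i j) =
      B (x i + x j) (x i + x j) - B (x i) (x i) - B (x j) (x j) := by
    rw [e₁, e₂, h₁, h₂, h₂]
    abel
  rw [e]
  exact sub_mem (sub_mem (hB _) (hB _)) (hB _)

lemma mem_altPair_of_free {m : ℕ} {i j : Fin d} (hij : i ≠ j) {t : TPow k d (Fin m → k)}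
    (ht : perm k (Equiv.swap i j) t = t) : t ∈ altPair k i j (Fin m → k) := by
  classical
  let e : Fin m → Fin m → k := Pi.basisFun k (Fin m)
  let b : Module.Basis (Fin d → Fin m) k (TPow k d (Fin m → k)) :=
    Basis.piTensorProduct (fun _ => Pi.basisFun k (Fin m))
  have hb : ∀ w, b w = PiTensorProduct.tprod k (fun p => e (w p)) := fun w =>
    Basis.piTensorProduct_apply _ _
  have hperm : ∀ w, perm k (Equiv.swap i j) (b w) = b (w ∘ Equiv.swap i j) := fun w => by
    rw [hb, hb, perm_tprod]
    rfl
  have hinv : ∀ w : Fin d → Fin m, (w ∘ Equiv.swap i j) ∘ Equiv.swap i j = w := fun w => by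
    ext p
    simp
  have hc : ∀ w, b.repr t (w ∘ Equiv.swap i j) = b.repr t w := by
    have h : (b.repr.toLinearMap ∘ₗ perm k (Equiv.swap i j)) =
        (Finsupp.lmapDomain k k (fun w : Fin d → Fin m => w ∘ Equiv.swap i j)) ∘ₗ
          b.repr.toLinearMap := by
      refine b.ext fun w => ?_
      simp [hperm]
    intro w
    have h' := LinearMap.congr_fun h t
    simp only [LinearMap.comp_apply, ht, LinearEquiv.coe_coe, Finsupp.lmapDomain_apply] at h'
    have hinj : Function.Injective (fun w : Fin d → Fin m => w ∘ Equiv.swap i j) :=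
      Function.LeftInverse.injective (g := fun w => w ∘ Equiv.swap i j) hinv
    conv_lhs => rw [h']
    exact Finsupp.mapDomain_apply hinj _ _
  rw [← Submodule.Quotient.mk_eq_zero, ← Submodule.mkQ_apply, ← b.sum_repr t, map_sum]
  refine Finset.sum_involution (fun w _ => w ∘ Equiv.swap i j) ?_ ?_ (fun _ _ => Finset.mem_univ _)
    (fun w _ => hinv w)
  · intro w _
    rw [hc, ← map_add, ← smul_add, map_smul, hb, hb]
    have : (altPair k i j (Fin m → k)).mkQ (PiTensorProduct.tprod k (fun p => e (w p)) +
        PiTensorProduct.tprod k (fun p => e ((w ∘ Equiv.swap i j) p))) = 0 := by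
      rw [Submodule.mkQ_apply, Submodule.Quotient.mk_eq_zero]
      exact altPair_add_swap hij (fun p => e (w p))
    rw [this, smul_zero]
  · intro w _ hw heq
    apply hw
    rw [map_smul, hb]
    have : (altPair k i j (Fin m → k)).mkQ (PiTensorProduct.tprod k (fun p => e (w p))) = 0 := by
      rw [Submodule.mkQ_apply, Submodule.Quotient.mk_eq_zero]
      refine Submodule.subset_span ⟨_, ?_, rfl⟩
      have := congrFun heq j
      simp only [Function.comp_apply, Equiv.swap_apply_right] at this
      rw [this]
    rw [this, smul_zero]

/-- Over a finitely generated projective module, a tensor that is fixed by the exchange of two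
places is a combination of pure tensors with equal factors in these places. -/
lemma mem_altPair [Module.Finite k M] [Module.Projective k M] {i j : Fin d} (hij : i ≠ j)
    {t : TPow k d M} (ht : perm k (Equiv.swap i j) t = t) : t ∈ altPair k i j M := by
  obtain ⟨m, p, s, -, -, hps⟩ := Module.Finite.exists_comp_eq_id_of_projective k M
  have h := mem_altPair_of_free (k := k) hij
    (t := actT (PiTensorProduct.tprod k (fun _ : Fin d => s)) t)
    (by rw [perm_actT (diag_mem s), ht])
  have hle : altPair k i j (Fin m → k) ≤
      (altPair k i j M).comap (actT (PiTensorProduct.tprod k (fun _ : Fin d => p))) := by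
    refine Submodule.span_le.2 ?_
    rintro _ ⟨x, hx, rfl⟩
    refine Submodule.subset_span ⟨fun q => p (x q), congrArg p hx, ?_⟩
    rw [actT_tprod]
  have h' := hle h
  rw [Submodule.mem_comap, ← actT_compT, compT_tprod, hps] at h'
  have := actT_idT t
  rw [idT] at this
  rwa [this] at h'

lemma altRel_le (l : Weight n d) {V W : DivCat k d} (f : V ⟶ W) :
    altRel k l V.carrier ≤ (altRel k l W.carrier).comap (actT (DivCat.val f)) := by
  refine Submodule.span_le.2 ?_
  rintro _ ⟨i, j, x, hij, hb, hx, rfl⟩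
  have hfix : perm k (Equiv.swap i j) (PiTensorProduct.tprod k x) = PiTensorProduct.tprod k x := by
    rw [perm_tprod]
    congr 1
    ext p
    rcases eq_or_ne p i with rfl | hi
    · simp [hx]
    · rcases eq_or_ne p j with rfl | hj
      · simp [hx]
      · simp [Equiv.swap_apply_of_ne_of_ne, hi, hj]
  have h := mem_altPair hij (t := actT (DivCat.val f) (PiTensorProduct.tprod k x))
    (by rw [perm_actT (DivCat.val_mem f), hfix])
  have hle : altPair k i j W.carrier ≤ altRel k l W.carrier := by
    refine Submodule.span_le.2 ?_
    rintro _ ⟨y, hy, rfl⟩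
    exact Submodule.subset_span ⟨i, j, y, hij, hb, hy, rfl⟩
  exact hle h

end Alt

/-- `∧^l = ∧^{l 0} ⊗ ∧^{l 1} ⊗ ⋯`, as a quotient of `V^{⊗ d}` at `V`. -/
def Wedge (k : Type u) [CommRing k] (l : Weight n d) : SPF k d :=
  SPF.of (fun V => TPow k d V.carrier ⧸ altRel k l V.carrier)
    (fun {V W} =>
      { toFun := fun f => Submodule.mapQ _ _ (actT (DivCat.val f)) (altRel_le l f)
        map_add' := fun f g => by
          refine Submodule.linearMap_qext _ (LinearMap.ext fun t => ?_)
          simp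
        map_smul' := fun r f => by
          refine Submodule.linearMap_qext _ (LinearMap.ext fun t => ?_)
          simp })
    (fun V t => by
      obtain ⟨t, rfl⟩ := Submodule.mkQ_surjective _ t
      simp [actT_idT])
    (fun f g t => by
      obtain ⟨t, rfl⟩ := Submodule.mkQ_surjective _ t
      simp [actT_compT])

/-! ## Permutation modules -/

/-- The permutation module `M^l = k[S_d / S_l]` of the symmetric group. -/
abbrev permModule (k : Type u) [CommRing k] (l : Weight n d) :
    Representation k (Equiv.Perm (Fin d)) (MonoidAlgebra k (Equiv.Perm (Fin d) ⧸ l.young)) :=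
  Representation.ofMulAction k (Equiv.Perm (Fin d)) (Equiv.Perm (Fin d) ⧸ l.young)

end
end StrictPoly

/-!
A morphism `k^d ⟶ V` of `Γ^d P_k` can take `e₁ ⊗ ⋯ ⊗ e_d` to any tensor in `V^{⊗ d}`, so `k^d` plays
the role of a generic object and all three kinds of functors can be described by tensors. Let `Ω` be
the `S_d`-set of words with `l i` letters `i`, isomorphic to `S_d / S_l`. Then `Sym^l(V)` and
`∧^l(V)` are quotients of `k[Ω] ⊗ V^{⊗ d}` by the relations `σ z ∼ ε(σ) z` for the trivial character
and the sign, together with the vanishing of tensors with equal factors in the case of `∧^l`. If `X`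
is one of `Γ^l`, `Sym^l` and `∧^l`, then every element of `X(V)` has coefficients in `V^{⊗ d}`
indexed by `Ω` (for `Sym^l` and `∧^l`, the sum over `S_d` of the translates of a representative,
weighted by `ε`), and there are elements of `X(k^d)` dual to them which generate `X` inside the
coend.

If `X` has coefficients in `Ω` and `Y` is a quotient of `k[Ω'] ⊗ V^{⊗ d}`, then `X ⊗̲ Y` is the
quotient of `k[Ω × Ω'] ⊗ U^{⊗ d}` by the products of the coefficients of `X` with the relations of
`Y`. These contain the relations twisted by the product of the two characters. Tensors with equal
factors that vanish in `Y` give further relations if `X = Γ^λ`, but not after averaging, because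
the terms for `σ` and for its product with the transposition of the equal factors combine.
Finally the words for `λ` times the words for `μ` are the disjoint union, over the matrices with row
sums `μ` and column sums `λ`, of the words for the entries of the matrix.
-/

namespace StrictPoly

noncomputable section

/-! ## Tensor powers -/

section TensorPowers

variable {k : Type u} [CommRing k] {d n : ℕ}
variable {M N P Q : Type u} [AddCommGroup M] [Module k M] [AddCommGroup N] [Module k N]
  [AddCommGroup P] [Module k P] [AddCommGroup Q] [Module k Q]

lemma tpow_hom_ext {f g : TPow k d M →ₗ[k] N}
    (h : ∀ x : Fin d → M, f (PiTensorProduct.tprod k x) = g (PiTensorProduct.tprod k x)) :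
    f = g :=
  PiTensorProduct.ext (MultilinearMap.ext h)

lemma perm_one : perm k (1 : Equiv.Perm (Fin d)) = (LinearMap.id : TPow k d M →ₗ[k] _) :=
  tpow_hom_ext fun x => by
    rw [perm_tprod]
    rfl

lemma perm_mul (σ τ : Equiv.Perm (Fin d)) (t : TPow k d M) :
    perm k (σ * τ) t = perm k σ (perm k τ t) :=
  LinearMap.congr_fun (g := perm k σ ∘ₗ perm k τ)
    (tpow_hom_ext fun x => by simp [Equiv.Perm.mul_def]) t

/-- The sum of all permutations of a tensor. -/
def symmetrize : TPow k d M →ₗ[k] TPow k d M :=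
  ∑ σ : Equiv.Perm (Fin d), perm k σ

lemma symmetrize_apply (t : TPow k d M) :
    symmetrize t = ∑ σ : Equiv.Perm (Fin d), perm k σ t := by
  rw [symmetrize, LinearMap.sum_apply]

lemma symmetrize_mem (t : TPow k d M) : symmetrize t ∈ DPow k d M := fun σ _ => by
  simp_rw [symmetrize_apply, map_sum, ← perm_mul]
  exact Fintype.sum_equiv (Equiv.mulLeft σ) _ _ fun _ => rfl

lemma place₂_symmetrize_left (b : M →ₗ[k] N →ₗ[k] P) (s : TPow k d M) {t : TPow k d N}
    (ht : t ∈ DPow k d N) : place₂ d b (symmetrize s) t = symmetrize (place₂ d b s t) := by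
  simp only [symmetrize_apply, map_sum, LinearMap.sum_apply, perm_place₂]
  exact Finset.sum_congr rfl fun σ _ => by rw [ht σ trivial]

lemma place₂_symmetrize_right (b : M →ₗ[k] N →ₗ[k] P) {s : TPow k d M} (t : TPow k d N)
    (hs : s ∈ DPow k d M) : place₂ d b s (symmetrize t) = symmetrize (place₂ d b s t) := by
  simp only [symmetrize_apply, map_sum, perm_place₂]
  exact Finset.sum_congr rfl fun σ _ => by rw [hs σ trivial]

lemma sum_tprod_perm (A : Fin d → Fin d → M) (hA : ∀ i j, i ≠ j → A i j = 0) :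
    ∑ σ : Equiv.Perm (Fin d), PiTensorProduct.tprod k (fun i => A i (σ.symm i)) =
      PiTensorProduct.tprod k (fun i => A i i) := by
  rw [Finset.sum_eq_single_of_mem 1 (Finset.mem_univ _)]
  · rfl
  · intro σ _ hσ
    obtain ⟨i, hi⟩ : ∃ i, i ≠ σ.symm i := by
      by_contra! h
      exact hσ (Equiv.ext fun i => by simpa using congrArg σ (h i))
    exact (PiTensorProduct.tprod k).map_coord_zero i (hA _ _ hi)

/-- The tensor product `M^{⊗ d} × N^{⊗ d} → (M ⊗ N)^{⊗ d}`, place by place. -/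
def tmulT : TPow k d M →ₗ[k] TPow k d N →ₗ[k] TPow k d (M ⊗[k] N) :=
  place₂ d (TensorProduct.mk k M N)

@[simp] lemma tmulT_tprod (x : Fin d → M) (y : Fin d → N) :
    tmulT (PiTensorProduct.tprod k x) (PiTensorProduct.tprod k y) =
      PiTensorProduct.tprod k (fun i => x i ⊗ₜ[k] y i) := place₂_tprod _ _ _

lemma actT_tensT_tmulT (f : TPow k d (M →ₗ[k] N)) (g : TPow k d (P →ₗ[k] Q)) (s : TPow k d M)
    (t : TPow k d P) : actT (tensT f g) (tmulT s t) = tmulT (actT f s) (actT g t) := by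
  induction f using tpow_induction with
  | h f =>
    induction g using tpow_induction with
    | h g =>
      induction s using tpow_induction with
      | h s => induction t using tpow_induction <;> simp_all
      | _ => simp_all
    | _ => simp_all
  | _ => simp_all

/-! ## The tensors of basis vectors of a free module -/

/-- The tensor `e_{q 1} ⊗ ⋯ ⊗ e_{q d}` of basis vectors of `k^n` given by a word `q`. -/
def wordTensor (k : Type u) [CommRing k] (q : Fin d → Fin n) : TPow k d (Fin n → k) :=
  PiTensorProduct.tprod k fun p => Pi.single (q p) 1

lemma perm_wordTensor (σ : Equiv.Perm (Fin d)) (q : Fin d → Fin n) :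
    perm k σ (wordTensor k q) = wordTensor k (q ∘ σ.symm) := by
  simp [wordTensor]

lemma single_one_mul_single_one {i j : Fin n} (h : i ≠ j) :
    (Pi.single i 1 * Pi.single j 1 : Fin n → k) = 0 := by
  rw [← Pi.single_mul_left, Pi.single_eq_of_ne h, mul_zero, Pi.single_zero]

lemma actT_mul_wordTensor (q r : Fin d → Fin n) :
    actT (PiTensorProduct.tprod k fun _ => LinearMap.mul' k (Fin n → k))
      (tmulT (wordTensor k q) (wordTensor k r)) = if q = r then wordTensor k r else 0 := by
  simp only [wordTensor, tmulT_tprod, actT_tprod, LinearMap.mul'_apply]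
  split_ifs with h
  · simp [h, ← Pi.single_mul]
  · obtain ⟨p, hp⟩ := Function.ne_iff.1 h
    exact (PiTensorProduct.tprod k).map_coord_zero p (single_one_mul_single_one hp)

/-- The tensor product of the rank one maps `e_i ↦ x_i` given by a tensor `x₁ ⊗ ⋯ ⊗ x_d`. -/
def rankOneT : TPow k d M →ₗ[k] TPow k d ((Fin d → k) →ₗ[k] M) :=
  place₂ d (LinearMap.smulRightₗ (R := k) (M₂ := Fin d → k) (M := M))
    (PiTensorProduct.tprod k fun i => LinearMap.proj i)

@[simp] lemma rankOneT_tprod (x : Fin d → M) :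
    rankOneT (PiTensorProduct.tprod k x) = PiTensorProduct.tprod k
      (fun i => (LinearMap.proj i : (Fin d → k) →ₗ[k] k).smulRight (x i)) :=
  place₂_tprod _ _ _

lemma compT_rankOneT (f : TPow k d (M →ₗ[k] N)) (t : TPow k d M) :
    compT f (rankOneT t) = rankOneT (actT f t) := by
  induction f using tpow_induction with
  | h f =>
    induction t using tpow_induction with
    | h t =>
      simp only [rankOneT_tprod, compT_tprod, actT_tprod]
      congr! 2 with i
      exact LinearMap.ext fun v => by simp
    | _ => simp_all
  | _ => simp_all

lemma actT_symmetrize_rankOneT (t : TPow k d M) :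
    actT (symmetrize (rankOneT t)) (wordTensor k id) = t := by
  refine LinearMap.congr_fun (f := actT.flip (wordTensor k id) ∘ₗ symmetrize ∘ₗ rankOneT)
    (g := LinearMap.id) (tpow_hom_ext fun x => ?_) t
  simp only [LinearMap.comp_apply, rankOneT_tprod, symmetrize_apply, LinearMap.flip_apply,
    map_sum, perm_tprod, wordTensor, actT_tprod, LinearMap.id_apply,
    id_eq]
  rw [sum_tprod_perm fun i j => ((LinearMap.proj j : (Fin d → k) →ₗ[k] k).smulRight (x j))
    (Pi.single i 1)]
  · simp
  · intro i j hij
    simp [Pi.single_eq_of_ne hij.symm]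

/-- The tensor of the maps `v ↦ v ⊗ e_i` from `M` to `M ⊗ k^d`. -/
def placeT (k : Type u) [CommRing k] (d : ℕ) (M : Type u) [AddCommGroup M] [Module k M] :
    TPow k d (M →ₗ[k] M ⊗[k] (Fin d → k)) :=
  PiTensorProduct.tprod k fun i => (TensorProduct.mk k M (Fin d → k)).flip (Pi.single i 1)

lemma actT_symmetrize_placeT (t : TPow k d M) :
    actT (symmetrize (placeT k d M)) t =
      ∑ σ : Equiv.Perm (Fin d), tmulT t (perm k σ (wordTensor k id)) := by
  refine (LinearMap.congr_fun (f := actT (symmetrize (placeT k d M)))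
    (g := ∑ σ : Equiv.Perm (Fin d), tmulT.flip (perm k σ (wordTensor k id)))
    (tpow_hom_ext fun x => ?_) t).trans (by simp)
  simp [placeT, symmetrize_apply, wordTensor]

/-- The multiplication of `k^d` in the second factor of `M ⊗ k^d`. -/
def mulRight (k : Type u) [CommRing k] (d : ℕ) (M : Type u) [AddCommGroup M] [Module k M] :
    (M ⊗[k] (Fin d → k)) ⊗[k] (Fin d → k) →ₗ[k] M ⊗[k] (Fin d → k) :=
  (LinearMap.mul' k (Fin d → k)).lTensor M ∘ₗ
    (TensorProduct.assoc k M (Fin d → k) (Fin d → k)).toLinearMap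

@[simp] lemma mulRight_tmul (v : M) (a b : Fin d → k) :
    mulRight k d M ((v ⊗ₜ a) ⊗ₜ b) = v ⊗ₜ (a * b) := by
  simp [mulRight]

lemma compT_mulRight_tensT (b : TPow k d (P →ₗ[k] M)) :
    compT (PiTensorProduct.tprod k fun _ => mulRight k d M)
      (tensT (symmetrize (compT (placeT k d M) b)) (symmetrize (rankOneT (wordTensor k id)))) =
        symmetrize (tensT b (rankOneT (wordTensor k id))) := by
  rw [tensT, place₂_symmetrize_left _ _ (symmetrize_mem _), ← tensT, compT,
    place₂_symmetrize_right _ _ (diag_mem _), ← compT]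
  congr 1
  induction b using tpow_induction with
  | h b =>
    simp only [placeT, wordTensor, rankOneT_tprod, symmetrize_apply, map_sum, perm_tprod,
      tensT_tprod, compT_tprod, id_eq]
    -- Only `σ = 1` survives, since `e_{σ i} e_i = 0` if `σ i ≠ i`.
    rw [sum_tprod_perm fun i j => mulRight k d M ∘ₗ TensorProduct.map
      ((TensorProduct.mk k M (Fin d → k)).flip (Pi.single i 1) ∘ₗ b i)
        ((LinearMap.proj j : (Fin d → k) →ₗ[k] k).smulRight (Pi.single j (1 : k)))]
    · congr! 2 with i
      exact TensorProduct.ext' fun v a => by simp [← Pi.single_mul]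
    · exact fun i j hij => TensorProduct.ext' fun v a => by simp [single_one_mul_single_one hij]
  | _ => simp_all

lemma tensT_idT_symmetrize (b : TPow k d (P →ₗ[k] Q)) :
    tensT (idT k d M) (symmetrize b) = symmetrize (tensT (idT k d M) b) :=
  place₂_symmetrize_right _ _ (diag_mem _)

lemma tensT_rankOneT (s : TPow k d M) (t : TPow k d N) :
    tensT (rankOneT s) (rankOneT t) =
      compT (rankOneT (tmulT s t)) (PiTensorProduct.tprod k fun _ => LinearMap.mul' k _) := by
  induction s using tpow_induction with
  | h x =>
    induction t using tpow_induction with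
    | h y =>
      simp only [rankOneT_tprod, tensT_tprod, tmulT_tprod, compT_tprod]
      congr! 2 with i
      exact TensorProduct.ext' fun v a => by
        simp [smul_smul, mul_comm, ← TensorProduct.smul_tmul']
    | _ => simp_all
  | _ => simp_all

lemma compT_placeT_rankOneT (t : TPow k d M) :
    compT (placeT k d M) (rankOneT t) = rankOneT (tmulT t (wordTensor k id)) := by
  rw [compT_rankOneT]
  congr 1
  induction t using tpow_induction with
  | h x => simp [placeT, wordTensor]
  | _ => simp_all

end TensorPowers

variable {k : Type u} [CommRing k] {d : ℕ}

namespace DivCat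

/-- The tensor power `V^{⊗ d}`. -/
abbrev T (V : DivCat k d) : Type u := TPow k d V.carrier

/-- The action of a morphism of `Γ^d P_k` on tensor powers. -/
def tact {V W : DivCat k d} (f : V ⟶ W) : V.T →ₗ[k] W.T := actT (val f)

/-- The product `V^{⊗ d} × W^{⊗ d} → (V ⊗ W)^{⊗ d}`. -/
def tmul {V W : DivCat k d} : V.T →ₗ[k] W.T →ₗ[k] (V.tensor W).T := tmulT

/-- The tensor `e_{q 1} ⊗ ⋯ ⊗ e_{q d}` of basis vectors of `k^d` given by a word `q`. -/
def word (k : Type u) [CommRing k] (q : Fin d → Fin d) : (free k d d).T := wordTensor k q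

/-- The tensor `e₁ ⊗ ⋯ ⊗ e_d` of `k^d`. -/
abbrev std (k : Type u) [CommRing k] (d : ℕ) : (free k d d).T := word k id

lemma tact_id {V : DivCat k d} (t : V.T) : tact (𝟙 V) t = t := actT_idT t

lemma tact_comp {U V W : DivCat k d} (f : U ⟶ V) (g : V ⟶ W) (t : U.T) :
    tact (f ≫ g) t = tact g (tact f t) := actT_compT _ _ t

lemma perm_tact {V W : DivCat k d} (f : V ⟶ W) (σ : Equiv.Perm (Fin d)) (t : V.T) :
    perm k σ (tact f t) = tact f (perm k σ t) := perm_actT (val_mem f) σ t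

lemma perm_tmul {V W : DivCat k d} (σ : Equiv.Perm (Fin d)) (s : V.T) (t : W.T) :
    perm k σ (tmul s t) = tmul (perm k σ s) (perm k σ t) := perm_place₂ _ _ _ _

lemma perm_word (σ : Equiv.Perm (Fin d)) (q : Fin d → Fin d) :
    perm k σ (word k q) = word k (q ∘ σ.symm) := perm_wordTensor σ q

lemma tact_tensorHom {V V' W W' : DivCat k d} (f : V ⟶ V') (g : W ⟶ W') (s : V.T) (t : W.T) :
    tact (tensorHom f g) (tmul s t) = tmul (tact f s) (tact g t) := actT_tensT_tmulT _ _ s t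

/-- The morphism `k^d ⟶ V` that takes the tensor `e₁ ⊗ ⋯ ⊗ e_d` to a given one. -/
def ofTensor {V : DivCat k d} : V.T →ₗ[k] (free k d d ⟶ V) :=
  (symmetrize ∘ₗ rankOneT).codRestrict (DPow k d ((Fin d → k) →ₗ[k] V.carrier))
    fun _ => symmetrize_mem _

lemma tact_ofTensor {V : DivCat k d} (t : V.T) : tact (ofTensor t) (std k d) = t :=
  actT_symmetrize_rankOneT t

lemma ofTensor_comp {V W : DivCat k d} (t : V.T) (φ : V ⟶ W) :
    ofTensor t ≫ φ = ofTensor (tact φ t) :=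
  val_injective <| (place₂_symmetrize_right _ _ (val_mem φ)).trans <|
    congrArg symmetrize (compT_rankOneT _ _)

/-- The morphism `k^d ⟶ U` that takes each basis vector `e_p` to `u_p`. -/
def ofVectors {U : DivCat k d} (u : Fin d → U.carrier) : free k d d ⟶ U :=
  diag (V := free k d d) (Fintype.linearCombination k u)

lemma tact_ofVectors {U : DivCat k d} (u : Fin d → U.carrier) (q : Fin d → Fin d) :
    tact (ofVectors u) (word k q) = PiTensorProduct.tprod k (u ∘ q) :=
  (actT_tprod _ _).trans <| congrArg _ <| funext fun p =>
    (Fintype.linearCombination_apply_single k u (q p) 1).trans (one_smul k _)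

/-- The sum over `σ` of the morphisms given by
`v₁ ⊗ ⋯ ⊗ v_d ↦ (v₁ ⊗ e_{σ 1}) ⊗ ⋯ ⊗ (v_d ⊗ e_{σ d})`, as a morphism of `Γ^d P_k`. -/
def incl (V : DivCat k d) : V ⟶ V.tensor (free k d d) :=
  ⟨symmetrize (placeT k d V.carrier), symmetrize_mem _⟩

lemma tact_incl {V : DivCat k d} (t : V.T) :
    tact V.incl t = ∑ σ : Equiv.Perm (Fin d), tmul t (perm k σ (std k d)) :=
  actT_symmetrize_placeT t

/-- The multiplication `k^d ⊗ k^d ⟶ k^d`. -/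
def mul (k : Type u) [CommRing k] (d : ℕ) : (free k d d).tensor (free k d d) ⟶ free k d d :=
  diag (V := (free k d d).tensor (free k d d)) (W := free k d d) (LinearMap.mul' k (Fin d → k))

lemma tact_mul_word (q r : Fin d → Fin d) :
    tact (mul k d) (tmul (word k q) (word k r)) = if q = r then word k r else 0 :=
  actT_mul_wordTensor q r

/-- The morphism `(V ⊗ k^d) ⊗ k^d ⟶ V ⊗ k^d` given by the multiplication of `k^d`. -/
def tensorMul (V : DivCat k d) :
    (V.tensor (free k d d)).tensor (free k d d) ⟶ V.tensor (free k d d) :=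
  diag (V := (V.tensor (free k d d)).tensor (free k d d)) (W := V.tensor (free k d d))
    (mulRight k d V.carrier)

lemma incl_tensorMul (V : DivCat k d) :
    tensorHom V.incl (ofTensor (std k d)) ≫ V.tensorMul = tensorHom (𝟙 V) (ofTensor (std k d)) := by
  have h := compT_mulRight_tensT (d := d) (idT k d V.carrier)
  rw [compT_idT, ← tensT_idT_symmetrize] at h
  exact val_injective h

lemma ofTensor_tmul_tensorMul {V : DivCat k d} (t : V.T) :
    tensorHom (ofTensor (tmul t (std k d))) (ofTensor (std k d)) ≫ V.tensorMul =
      mul k d ≫ ofTensor (tmul t (std k d)) := by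
  have h := compT_mulRight_tensT (rankOneT t)
  rw [compT_placeT_rankOneT, tensT_rankOneT] at h
  exact val_injective (h.trans (place₂_symmetrize_left _ _ (diag_mem _)).symm)

end DivCat

namespace SPF

/-- A natural family of linear isomorphisms gives an isomorphism of strict polynomial functors. -/
def isoOfLinearEquiv {X Y : SPF k d} (e : ∀ V, X.val V ≃ₗ[k] Y.val V)
    (h : ∀ {V W : DivCat k d} (f : V ⟶ W) (x : X.val V), e W (X.act f x) = Y.act f (e V x)) :
    X ≅ Y :=
  ObjectProperty.isoMk _ <| NatIso.ofComponents (fun V => (e V).toModuleIso) fun f => by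
    ext x
    exact h f x

/-! ## Maps out of the internal tensor product -/

section Coend

variable {X Y Z : SPF k d}

/-- The class of `φ ⊗ x ⊗ y` in the coend. -/
def coendMk (V W : DivCat k d) {U : DivCat k d} :
    (V.tensor W ⟶ U) →ₗ[k] X.val V →ₗ[k] Y.val W →ₗ[k] Coend X Y U :=
  open scoped Classical in
  TensorProduct.lcurry (.id k) (X.val V) (Y.val W) (Coend X Y U) ∘ₗ
    TensorProduct.curry ((coendRel X Y U).mkQ ∘ₗ DirectSum.lof k (DivCat k d × DivCat k d)
      (fun p => (p.1.tensor p.2 ⟶ U) ⊗[k] (X.val p.1 ⊗[k] Y.val p.2)) (V, W))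

lemma coendMk_apply {U V W : DivCat k d} (φ : V.tensor W ⟶ U) (x : X.val V) (y : Y.val W) :
    coendMk V W φ x y = (coendRel X Y U).mkQ (coendι X Y V W φ x y) := rfl

lemma coendMk_act {U V V' W W' : DivCat k d} (g : V ⟶ V') (h : W ⟶ W') (φ : V'.tensor W' ⟶ U)
    (x : X.val V) (y : Y.val W) :
    coendMk V' W' φ (X.act g x) (Y.act h y) = coendMk V W (DivCat.tensorHom g h ≫ φ) x y := by
  rw [eq_comm, ← sub_eq_zero, coendMk_apply, coendMk_apply, ← map_sub, Submodule.mkQ_apply,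
    Submodule.Quotient.mk_eq_zero]
  exact Submodule.subset_span ⟨_, _, _, _, g, h, φ, x, y, rfl⟩

lemma mem_of_coendMk_mem {U : DivCat k d} {S : Submodule k (Coend X Y U)}
    (h : ∀ V W φ x y, coendMk (X := X) (Y := Y) V W φ x y ∈ S) (c : Coend X Y U) : c ∈ S := by
  have : S.mkQ = 0 := coend_hom_ext fun V W φ x y =>
    (Submodule.Quotient.mk_eq_zero S).2 (h V W φ x y)
  exact (Submodule.Quotient.mk_eq_zero S).1 (LinearMap.congr_fun this c)

variable (b : ∀ V W : DivCat k d, X.val V →ₗ[k] Y.val W →ₗ[k] Z.val (V.tensor W))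

/-- The map on the sum of the `Hom(V ⊗ W, U) ⊗ X(V) ⊗ Y(W)` given by bilinear maps
`X(V) × Y(W) → Z(V ⊗ W)`. -/
def coendSumDesc (U : DivCat k d) : CoendSum X Y U →ₗ[k] Z.val U :=
  open scoped Classical in
  DirectSum.toModule k _ _ fun p => TensorProduct.lift
    (LinearMap.lcomp k (Z.val U) (TensorProduct.lift (b p.1 p.2)) ∘ₗ Z.actₗ)

lemma coendSumDesc_ι {U V W : DivCat k d} (φ : V.tensor W ⟶ U) (x : X.val V) (y : Y.val W) :
    coendSumDesc b U (coendι X Y V W φ x y) = Z.act φ (b V W x y) := by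
  classical
  exact (DirectSum.toModule_lof k (V, W) _).trans (by simp [actₗ])

variable (hb : ∀ {V V' W W' : DivCat k d} (g : V ⟶ V') (h : W ⟶ W') (x : X.val V) (y : Y.val W),
  Z.act (DivCat.tensorHom g h) (b V W x y) = b V' W' (X.act g x) (Y.act h y))

include hb in
lemma coendRel_le_ker (U : DivCat k d) : coendRel X Y U ≤ LinearMap.ker (coendSumDesc b U) := by
  refine Submodule.span_le.2 ?_
  rintro _ ⟨V, V', W, W', g, h, φ, x, y, rfl⟩
  rw [SetLike.mem_coe, LinearMap.mem_ker, map_sub, coendSumDesc_ι, coendSumDesc_ι, act_comp, hb,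
    sub_self]

/-- The map on the coend given by natural bilinear maps `X(V) × Y(W) → Z(V ⊗ W)`. -/
def coendDesc (U : DivCat k d) : Coend X Y U →ₗ[k] Z.val U :=
  Submodule.liftQ _ (coendSumDesc b U) (coendRel_le_ker b hb U)

lemma coendDesc_mk {U V W : DivCat k d} (φ : V.tensor W ⟶ U) (x : X.val V) (y : Y.val W) :
    coendDesc b hb U (coendMk V W φ x y) = Z.act φ (b V W x y) :=
  coendSumDesc_ι b φ x y

lemma coendDesc_map {U U' : DivCat k d} (ψ : U ⟶ U') (c : Coend X Y U) :
    coendDesc b hb U' (coendMap X Y ψ c) = Z.act ψ (coendDesc b hb U c) := by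
  have : coendDesc b hb U' ∘ₗ coendMap X Y ψ = Z.act ψ ∘ₗ coendDesc b hb U := by
    refine coend_hom_ext fun V W φ x y => ?_
    rw [LinearMap.comp_apply, LinearMap.comp_apply, coendMap_ι, ← coendMk_apply, ← coendMk_apply,
      coendDesc_mk, coendDesc_mk, act_comp]
  exact LinearMap.congr_fun this c

/-- The isomorphism from the internal tensor product given by natural bilinear maps
`X(V) × Y(W) → Z(V ⊗ W)` that induce bijections on the coends. -/
def internalTensorIso (hbij : ∀ U, Function.Bijective (coendDesc b hb U)) :
    internalTensor X Y ≅ Z :=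
  isoOfLinearEquiv (fun U => (coendEquiv X Y U).trans (LinearEquiv.ofBijective _ (hbij U)))
    fun {U U'} ψ z => by
      have h : coendEquiv X Y U' ((internalTensor X Y).act ψ z) =
          coendMap X Y ψ (coendEquiv X Y U z) :=
        (coendEquiv X Y U').apply_symm_apply _
      change coendDesc b hb U' (coendEquiv X Y U' ((internalTensor X Y).act ψ z)) = _
      rw [h, coendDesc_map]
      rfl

end Coend

end SPF

/-! ## Families of tensors indexed by an `S_d`-set -/

section Families

variable {Ω Ω' : Type} {V V' W W' : DivCat k d}

/-- The action of a morphism on every member of a family of tensors. -/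
def actPi (Ω : Type) (f : V ⟶ W) : (Ω → V.T) →ₗ[k] (Ω → W.T) := (DivCat.tact f).compLeft Ω

lemma actPi_apply (f : V ⟶ W) (z : Ω → V.T) (w : Ω) : actPi Ω f z w = DivCat.tact f (z w) := rfl

lemma actPi_single [DecidableEq Ω] (f : V ⟶ W) (w : Ω) (t : V.T) :
    actPi Ω f (Pi.single w t) = Pi.single w (DivCat.tact f t) :=
  (Pi.single_op (fun _ => DivCat.tact f) (fun _ => map_zero _) w t).symm

/-- The family of the `s w ⊗ t w'`, for `w` in `Ω` and `w'` in `Ω'`. -/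
def outer : (Ω → V.T) →ₗ[k] (Ω' → W.T) →ₗ[k] (Ω × Ω' → (V.tensor W).T) :=
  LinearMap.mk₂ k (fun s t p => DivCat.tmul (s p.1) (t p.2))
    (fun _ _ _ => funext fun _ => LinearMap.map_add₂ _ _ _ _)
    (fun _ _ _ => funext fun _ => LinearMap.map_smul₂ _ _ _ _)
    (fun _ _ _ => funext fun _ => map_add _ _ _)
    (fun r s t => funext fun p => map_smul (DivCat.tmul (s p.1)) r (t p.2))

lemma outer_apply (s : Ω → V.T) (t : Ω' → W.T) (p : Ω × Ω') :
    outer s t p = DivCat.tmul (s p.1) (t p.2) := rfl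

lemma actPi_outer (f : V ⟶ V') (g : W ⟶ W') (s : Ω → V.T) (t : Ω' → W.T) :
    actPi (Ω × Ω') (DivCat.tensorHom f g) (outer s t) = outer (actPi Ω f s) (actPi Ω' g t) :=
  funext fun _ => DivCat.tact_tensorHom _ _ _ _

lemma outer_single [Fintype Ω] [DecidableEq Ω] [DecidableEq Ω'] (s : Ω → V.T) (w' : Ω')
    (t : W.T) : outer s (Pi.single w' t) = ∑ w, Pi.single (w, w') (DivCat.tmul (s w) t) := by
  ext ⟨v, v'⟩ : 1
  rw [Finset.sum_apply, Finset.sum_eq_single_of_mem v (Finset.mem_univ v)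
    fun w _ hw => Pi.single_eq_of_ne (fun e => hw (congrArg Prod.fst e).symm) _, outer_apply]
  rcases eq_or_ne v' w' with rfl | h
  · rw [Pi.single_eq_same, Pi.single_eq_same]
  · rw [Pi.single_eq_of_ne h, map_zero, Pi.single_eq_of_ne fun e => h (congrArg Prod.snd e)]

variable [MulAction (Equiv.Perm (Fin d)) Ω'] [MulAction (Equiv.Perm (Fin d)) Ω]

/-- The action of a permutation of the places on families of tensors, `w ⊗ t ↦ σ w ⊗ σ t`. -/
def permPi (σ : Equiv.Perm (Fin d)) : (Ω → V.T) →ₗ[k] (Ω → V.T) :=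
  (perm k σ).compLeft Ω ∘ₗ LinearMap.funLeft k V.T (σ⁻¹ • ·)

lemma permPi_apply (σ : Equiv.Perm (Fin d)) (z : Ω → V.T) (w : Ω) :
    permPi σ z w = perm k σ (z (σ⁻¹ • w)) := rfl

lemma permPi_one (z : Ω → V.T) : permPi 1 z = z := by
  ext w : 1
  rw [permPi_apply, inv_one, one_smul, perm_one, LinearMap.id_apply]

lemma permPi_mul (σ τ : Equiv.Perm (Fin d)) (z : Ω → V.T) :
    permPi (σ * τ) z = permPi σ (permPi τ z) := by
  ext w : 1
  rw [permPi_apply, permPi_apply, permPi_apply, perm_mul, mul_inv_rev, mul_smul]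

lemma permPi_single [DecidableEq Ω] (σ : Equiv.Perm (Fin d)) (w : Ω) (t : V.T) :
    permPi σ (Pi.single w t) = Pi.single (σ • w) (perm k σ t) := by
  ext v : 1
  rw [permPi_apply]
  rcases eq_or_ne v (σ • w) with rfl | h
  · rw [inv_smul_smul, Pi.single_eq_same, Pi.single_eq_same]
  · rw [Pi.single_eq_of_ne h, Pi.single_eq_of_ne fun e => h (inv_smul_eq_iff.1 e), map_zero]

lemma actPi_permPi (f : V ⟶ W) (σ : Equiv.Perm (Fin d)) (z : Ω → V.T) :
    actPi Ω f (permPi σ z) = permPi σ (actPi Ω f z) :=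
  funext fun _ => (DivCat.perm_tact _ _ _).symm

lemma permPi_outer (σ : Equiv.Perm (Fin d)) (s : Ω → V.T) (t : Ω' → W.T) :
    permPi σ (outer s t) = outer (permPi σ s) (permPi σ t) :=
  funext fun _ => DivCat.perm_tmul _ _ _

lemma perm_swap_tprod {M : Type u} [AddCommGroup M] [Module k M] {i j : Fin d} {x : Fin d → M}
    (hx : x i = x j) :
    perm k (Equiv.swap i j) (PiTensorProduct.tprod k x) = PiTensorProduct.tprod k x := by
  rw [perm_tprod]
  congr 1
  ext p
  rw [Equiv.symm_swap, Equiv.swap_apply_def]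
  split_ifs with hi hj
  · rw [hi, hx]
  · rw [hj, hx]
  · rfl

lemma permPi_swap_single [DecidableEq Ω] {i j : Fin d} {w : Ω} (hw : Equiv.swap i j • w = w)
    {x : Fin d → V.carrier} (hx : x i = x j) :
    permPi (Equiv.swap i j) (Pi.single w (PiTensorProduct.tprod k x) : Ω → V.T) =
      Pi.single w (PiTensorProduct.tprod k x) := by
  rw [permPi_single, hw, perm_swap_tprod hx]

end Families

/-! ## Relations twisted by a character -/

section Relations

/-- The sign character of the symmetric group, with values in `k`. -/
def sgnChar (k : Type u) [CommRing k] (d : ℕ) : Equiv.Perm (Fin d) →* k :=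
  (Int.castRingHom k : ℤ →* k).comp ((Units.coeHom ℤ).comp Equiv.Perm.sign)

lemma sgnChar_mul_self : sgnChar k d * sgnChar k d = 1 := by
  ext σ
  simp [sgnChar, ← Int.cast_mul]

lemma sgnChar_swap {i j : Fin d} (hij : i ≠ j) : sgnChar k d (Equiv.swap i j) = -1 := by
  simp [sgnChar, Equiv.Perm.sign_swap hij]

lemma sgnChar_eq_one (h : (2 : k) = 0) : sgnChar k d = 1 := by
  ext σ
  rcases Int.units_eq_one_or (Equiv.Perm.sign σ) with hσ | hσ
  · simp [sgnChar, hσ]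
  · simpa [sgnChar, hσ, neg_eq_iff_add_eq_zero, one_add_one_eq_two] using h

variable {Ω Ω' : Type} [MulAction (Equiv.Perm (Fin d)) Ω] [MulAction (Equiv.Perm (Fin d)) Ω']
  {V W : DivCat k d}

/-- The relations `σ z ∼ ε(σ) z` of the quotient of `k[Ω] ⊗ V^{⊗ d}` on which the permutations act
by the character `ε`. -/
def charRel (Ω : Type) [MulAction (Equiv.Perm (Fin d)) Ω] (ε : Equiv.Perm (Fin d) →* k)
    (V : DivCat k d) : Submodule k (Ω → V.T) :=
  Submodule.span k {z | ∃ (σ : Equiv.Perm (Fin d)) (y : Ω → V.T), z = permPi σ y - ε σ • y}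

/-- The span of the `w ⊗ x₁ ⊗ ⋯ ⊗ x_d` with `x_i = x_j` for two places `i`, `j` whose exchange
fixes `w`. -/
def diagRel (Ω : Type) [DecidableEq Ω] [MulAction (Equiv.Perm (Fin d)) Ω] (V : DivCat k d) :
    Submodule k (Ω → V.T) :=
  Submodule.span k {z | ∃ (i j : Fin d) (w : Ω) (x : Fin d → V.carrier), i ≠ j ∧
    Equiv.swap i j • w = w ∧ x i = x j ∧ z = Pi.single w (PiTensorProduct.tprod k x)}

/-- The relations of an exterior power. -/
def extRel (Ω : Type) [DecidableEq Ω] [MulAction (Equiv.Perm (Fin d)) Ω] (V : DivCat k d) :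
    Submodule k (Ω → V.T) :=
  charRel Ω (sgnChar k d) V ⊔ diagRel Ω V

variable {ε ε' : Equiv.Perm (Fin d) →* k}

lemma permPi_sub_mem_charRel (σ : Equiv.Perm (Fin d)) (y : Ω → V.T) :
    permPi σ y - ε σ • y ∈ charRel Ω ε V :=
  Submodule.subset_span ⟨σ, y, rfl⟩

lemma charRel_le_iff [Finite Ω] [DecidableEq Ω] {N : Submodule k (Ω → V.T)} :
    charRel Ω ε V ≤ N ↔ ∀ (σ : Equiv.Perm (Fin d)) (w : Ω) (t : V.T),
      Pi.single (σ • w) (perm k σ t) - ε σ • (Pi.single w t : Ω → V.T) ∈ N := by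
  refine ⟨fun h σ w t => permPi_single σ w t ▸ h (permPi_sub_mem_charRel σ _), fun h => ?_⟩
  refine Submodule.span_le.2 ?_
  rintro _ ⟨σ, y, rfl⟩
  have key : N.mkQ ∘ₗ (permPi σ - ε σ • LinearMap.id) = 0 := LinearMap.pi_ext fun w t =>
    (Submodule.Quotient.mk_eq_zero N).2 <| by
      rw [LinearMap.sub_apply, LinearMap.smul_apply, LinearMap.id_apply, permPi_single]
      exact h σ w t
  exact (Submodule.Quotient.mk_eq_zero N).1 (LinearMap.congr_fun key y)

lemma permPi_swap_add_mem_charRel {i j : Fin d} (hij : i ≠ j) (y : Ω → V.T) :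
    y + permPi (Equiv.swap i j) y ∈ charRel Ω (sgnChar k d) V := by
  have h := permPi_sub_mem_charRel (ε := sgnChar k d) (Equiv.swap i j) y
  rwa [sgnChar_swap hij, neg_one_smul, sub_neg_eq_add, add_comm] at h

variable [DecidableEq Ω]

lemma single_mem_diagRel {i j : Fin d} (hij : i ≠ j) {w : Ω} (hw : Equiv.swap i j • w = w)
    {t : V.T} (ht : perm k (Equiv.swap i j) t = t) :
    (Pi.single w t : Ω → V.T) ∈ diagRel Ω V := by
  have h : altPair k i j V.carrier ≤ (diagRel Ω V).comap (LinearMap.single k (fun _ => V.T) w) := by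
    refine Submodule.span_le.2 ?_
    rintro _ ⟨x, hx, rfl⟩
    exact Submodule.subset_span ⟨i, j, w, x, hij, hw, hx, rfl⟩
  exact h (mem_altPair hij ht)

lemma mem_extRel_of_permPi_swap [Finite Ω] {i j : Fin d} (hij : i ≠ j) {z : Ω → V.T}
    (hz : permPi (Equiv.swap i j) z = z) : z ∈ extRel Ω V := by
  cases nonempty_fintype Ω
  have hs : ∀ w, permPi (Equiv.swap i j) (Pi.single w (z w) : Ω → V.T) =
      Pi.single (Equiv.swap i j • w) (z (Equiv.swap i j • w)) := fun w => by
    conv_rhs => rw [← hz]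
    rw [permPi_single, permPi_apply, inv_smul_smul]
  rw [← Submodule.Quotient.mk_eq_zero, ← Submodule.mkQ_apply, ← Finset.univ_sum_single z, map_sum]
  refine Finset.sum_involution (fun w _ => Equiv.swap i j • w) (fun w _ => ?_) (fun w _ => ?_)
    (fun _ _ => Finset.mem_univ _) fun w _ => ?_
  · rw [← map_add, ← hs, Submodule.mkQ_apply, Submodule.Quotient.mk_eq_zero]
    exact Submodule.mem_sup_left (permPi_swap_add_mem_charRel hij _)
  · refine mt fun hw => (Submodule.Quotient.mk_eq_zero _).2 (Submodule.mem_sup_right ?_)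
    have h := hs w
    rw [permPi_single, hw] at h
    exact single_mem_diagRel hij hw (Pi.single_injective w h)
  · rw [smul_smul, Equiv.swap_mul_self, one_smul]

lemma extRel_eq_charRel (h : IsUnit (2 : k)) : extRel Ω V = charRel Ω (sgnChar k d) V := by
  refine sup_eq_left.2 (Submodule.span_le.2 ?_)
  rintro _ ⟨i, j, w, x, hij, hw, hx, rfl⟩
  obtain ⟨r, hr⟩ := h.exists_left_inv
  have hmem := permPi_swap_add_mem_charRel hij (Pi.single w (PiTensorProduct.tprod k x) : Ω → V.T)
  rw [permPi_swap_single hw hx, ← two_smul k] at hmem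
  have h := Submodule.smul_mem _ r hmem
  rwa [smul_smul, hr, one_smul] at h

end Relations

section Averaging

variable {Ω Ω' : Type} [MulAction (Equiv.Perm (Fin d)) Ω] [MulAction (Equiv.Perm (Fin d)) Ω']
  {V W : DivCat k d}

/-- The sum of the translates of a family of tensors, weighted by a character. It factors through
the quotient by `charRel Ω ε V`. -/
def averaging (ε : Equiv.Perm (Fin d) →* k) : (Ω → V.T) →ₗ[k] (Ω → V.T) :=
  ∑ σ : Equiv.Perm (Fin d), ε σ⁻¹ • permPi σ

variable {ε ε' : Equiv.Perm (Fin d) →* k}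

lemma averaging_apply (z : Ω → V.T) :
    averaging ε z = ∑ σ : Equiv.Perm (Fin d), ε σ⁻¹ • permPi σ z := by
  simp only [averaging, LinearMap.sum_apply, LinearMap.smul_apply]

lemma permPi_averaging (τ : Equiv.Perm (Fin d)) (z : Ω → V.T) :
    permPi τ (averaging ε z) = ε τ • averaging ε z := by
  rw [averaging_apply, map_sum, Finset.smul_sum]
  refine Fintype.sum_equiv (Equiv.mulLeft τ) _ _ fun σ => ?_
  rw [Equiv.coe_mulLeft, map_smul, smul_smul, mul_comm (ε τ), ← map_mul, mul_inv_rev,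
    inv_mul_cancel_right, permPi_mul]

lemma averaging_permPi (τ : Equiv.Perm (Fin d)) (z : Ω → V.T) :
    averaging ε (permPi τ z) = ε τ • averaging ε z := by
  rw [averaging_apply, averaging_apply, Finset.smul_sum]
  refine Fintype.sum_equiv (Equiv.mulRight τ) _ _ fun σ => ?_
  rw [Equiv.coe_mulRight, smul_smul, ← map_mul, mul_inv_rev, mul_inv_cancel_left, permPi_mul]

lemma actPi_averaging (f : V ⟶ W) (z : Ω → V.T) :
    actPi Ω f (averaging ε z) = averaging ε (actPi Ω f z) := by
  simp only [averaging_apply, map_sum, map_smul, actPi_permPi]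

lemma averaging_of_mem_charRel {z : Ω → V.T} (hz : z ∈ charRel Ω ε V) : averaging ε z = 0 := by
  suffices h : charRel Ω ε V ≤ LinearMap.ker (averaging ε) from h hz
  refine Submodule.span_le.2 ?_
  rintro _ ⟨σ, y, rfl⟩
  rw [SetLike.mem_coe, LinearMap.mem_ker, map_sub, map_smul, averaging_permPi, sub_self]

lemma averaging_of_mem_extRel [DecidableEq Ω] {z : Ω → V.T} (hz : z ∈ extRel Ω V) :
    averaging (sgnChar k d) z = 0 := by
  suffices h : extRel Ω V ≤ LinearMap.ker (averaging (sgnChar k d)) from h hz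
  refine sup_le (fun _ => averaging_of_mem_charRel) (Submodule.span_le.2 ?_)
  rintro _ ⟨i, j, w, x, hij, hw, hx, rfl⟩
  rw [SetLike.mem_coe, LinearMap.mem_ker, averaging_apply]
  refine Finset.sum_involution (fun σ _ => σ * Equiv.swap i j) (fun σ _ => ?_) (fun σ _ _ h => ?_)
    (fun _ _ => Finset.mem_univ _) fun σ _ => Equiv.mul_swap_mul_self i j σ
  · rw [permPi_mul, permPi_swap_single hw hx, mul_inv_rev, Equiv.swap_inv, map_mul,
      sgnChar_swap hij, neg_one_mul, neg_smul, add_neg_cancel]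
  · exact hij (Equiv.swap_eq_one_iff.1 (mul_eq_left.1 h))

lemma outer_mem_charRel {s : Ω → V.T} (hs : ∀ σ, permPi σ s = ε σ • s) {t : Ω' → W.T}
    (ht : t ∈ charRel Ω' ε' W) : outer s t ∈ charRel (Ω × Ω') (ε * ε') (V.tensor W) := by
  suffices h : charRel Ω' ε' W ≤ (charRel (Ω × Ω') (ε * ε') (V.tensor W)).comap (outer s) from h ht
  refine Submodule.span_le.2 ?_
  rintro _ ⟨σ, y, rfl⟩
  have hσ : outer s (permPi σ y) = ε σ⁻¹ • permPi σ (outer s y) := by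
    rw [permPi_outer, hs, LinearMap.map_smul₂, smul_smul, ← map_mul, inv_mul_cancel, map_one,
      one_smul]
  have h : outer s (permPi σ y - ε' σ • y) =
      ε σ⁻¹ • (permPi σ (outer s y) - (ε * ε') σ • outer s y) := by
    rw [map_sub, hσ, map_smul, smul_sub, smul_smul, MonoidHom.mul_apply, ← mul_assoc, ← map_mul,
      inv_mul_cancel, map_one, one_mul]
  rw [SetLike.mem_coe, Submodule.mem_comap, h]
  exact Submodule.smul_mem _ _ (permPi_sub_mem_charRel σ _)

variable [DecidableEq Ω']

lemma outer_mem_extRel [Finite Ω] [DecidableEq Ω] [Finite Ω'] {s : Ω → V.T}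
    (hs : ∀ σ, permPi σ s = s) {t : Ω' → W.T} (ht : t ∈ extRel Ω' W) :
    outer s t ∈ extRel (Ω × Ω') (V.tensor W) := by
  suffices h : extRel Ω' W ≤ (extRel (Ω × Ω') (V.tensor W)).comap (outer s) from h ht
  refine sup_le (fun t ht => Submodule.mem_sup_left ?_) (Submodule.span_le.2 ?_)
  · simpa only [one_mul] using outer_mem_charRel (ε := 1) (by simpa using hs) ht
  · rintro _ ⟨i, j, w, x, hij, hw, hx, rfl⟩
    refine mem_extRel_of_permPi_swap hij ?_
    rw [permPi_outer, hs, permPi_swap_single hw hx]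

lemma outer_averaging_mem_charRel (z : Ω → V.T) {t : Ω' → W.T} (ht : t ∈ extRel Ω' W) :
    outer (averaging ε z) t ∈ charRel (Ω × Ω') (ε * sgnChar k d) (V.tensor W) := by
  suffices h : extRel Ω' W ≤ (charRel (Ω × Ω') (ε * sgnChar k d) (V.tensor W)).comap
    (outer (averaging ε z)) from h ht
  refine sup_le (fun _ => outer_mem_charRel fun σ => permPi_averaging σ z) (Submodule.span_le.2 ?_)
  rintro _ ⟨i, j, w, x, hij, hw, hx, rfl⟩
  rw [SetLike.mem_coe, Submodule.mem_comap, averaging_apply, map_sum, LinearMap.sum_apply,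
    ← Submodule.Quotient.mk_eq_zero, ← Submodule.mkQ_apply, map_sum]
  refine Finset.sum_involution (fun σ _ => Equiv.swap i j * σ) (fun σ _ => ?_) (fun σ _ _ h => ?_)
    (fun _ _ => Finset.mem_univ _) fun σ _ => Equiv.swap_mul_self_mul i j σ
  · rw [← map_add, Submodule.mkQ_apply, Submodule.Quotient.mk_eq_zero]
    set t : Ω' → W.T := Pi.single w (PiTensorProduct.tprod k x)
    have hτ : outer (permPi (Equiv.swap i j * σ) z) t =
        permPi (Equiv.swap i j) (outer (permPi σ z) t) := by
      rw [permPi_outer, permPi_swap_single hw hx, permPi_mul]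
    have hc : ε (Equiv.swap i j) * ε (Equiv.swap i j) = 1 := by
      rw [← map_mul, Equiv.swap_mul_self, map_one]
    have h := Submodule.smul_mem _ (ε σ⁻¹ * ε (Equiv.swap i j)) (permPi_sub_mem_charRel
      (ε := ε * sgnChar k d) (Equiv.swap i j) (outer (permPi σ z) t))
    rw [MonoidHom.mul_apply, sgnChar_swap hij, mul_neg_one, neg_smul, sub_neg_eq_add, smul_add,
      smul_smul, mul_assoc (ε σ⁻¹), hc, mul_one, add_comm] at h
    rwa [LinearMap.map_smul₂, LinearMap.map_smul₂, hτ, mul_inv_rev, Equiv.swap_inv, map_mul]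
  · exact hij (Equiv.swap_eq_one_iff.1 (mul_eq_right.1 h))

end Averaging

namespace SPF

/-- A description of the functor `X` as the quotient of `k[Ω] ⊗ V^{⊗ d}` by the relations
`R V`. -/
structure Presentation (X : SPF k d) (Ω : Type)
    (R : ∀ V : DivCat k d, Submodule k (Ω → V.T)) where
  proj : ∀ V, (Ω → V.T) →ₗ[k] X.val V
  surjective : ∀ V, Function.Surjective (proj V)
  proj_eq_zero : ∀ {V} {z : Ω → V.T}, proj V z = 0 ↔ z ∈ R V
  act_proj : ∀ {V W : DivCat k d} (f : V ⟶ W) (z : Ω → V.T),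
    X.act f (proj V z) = proj W (actPi Ω f z)

namespace Presentation

variable {X : SPF k d} {Ω : Type} {R : ∀ V : DivCat k d, Submodule k (Ω → V.T)}
  (P : Presentation X Ω R) {V : DivCat k d} {M : Type*} [AddCommGroup M] [Module k M]

/-- The map on `X(V)` given by a map on `k[Ω] ⊗ V^{⊗ d}` that vanishes on the relations. -/
def desc (f : (Ω → V.T) →ₗ[k] M) (hf : R V ≤ LinearMap.ker f) : X.val V →ₗ[k] M :=
  (LinearMap.ker (P.proj V)).liftQ f (fun _ hz => hf (P.proj_eq_zero.1 hz)) ∘ₗ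
    ((P.proj V).quotKerEquivOfSurjective (P.surjective V)).symm.toLinearMap

lemma desc_proj (f : (Ω → V.T) →ₗ[k] M) (hf : R V ≤ LinearMap.ker f) (z : Ω → V.T) :
    P.desc f hf (P.proj V z) = f z := by
  rw [desc, LinearMap.comp_apply, LinearEquiv.coe_coe,
    show P.proj V z = (P.proj V).quotKerEquivOfSurjective (P.surjective V) (Submodule.mkQ _ z)
      from rfl, LinearEquiv.symm_apply_apply]
  exact Submodule.liftQ_apply _ _ _

lemma act_ofTensor [DecidableEq Ω] (w : Ω) (t : V.T) :
    X.act (DivCat.ofTensor t) (P.proj _ (Pi.single w (DivCat.std k d))) =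
      P.proj V (Pi.single w t) := by
  rw [P.act_proj, actPi_single, DivCat.tact_ofTensor]

end Presentation

lemma actPi_mul_outer_single {Ω Ω' : Type} [Finite Ω] [DecidableEq Ω] [DecidableEq Ω']
    {U : DivCat k d} {s : Ω → (DivCat.free k d d).T}
    {t : (DivCat.free k d d).T} {w : Ω} (hs : ∀ v, DivCat.tact (DivCat.mul k d)
      (DivCat.tmul (s v) t) = (Pi.single w t : Ω → (DivCat.free k d d).T) v)
    (ψ : DivCat.free k d d ⟶ U) (w' : Ω') :
    actPi _ (DivCat.mul k d ≫ ψ) (outer s (Pi.single w' t)) =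
      Pi.single (w, w') (DivCat.tact ψ t) := by
  cases nonempty_fintype Ω
  simp only [outer_single, map_sum, actPi_single, DivCat.tact_comp, hs]
  rw [Finset.sum_eq_single_of_mem w (Finset.mem_univ w) fun v _ hv => by
    rw [Pi.single_eq_of_ne hv, map_zero, Pi.single_zero], Pi.single_eq_same]

lemma coendMk_act_left {X Y : SPF k d} {U V V' W : DivCat k d} (g : V ⟶ V') {h : W ⟶ W}
    (φ : V'.tensor W ⟶ U) (x : X.val V) {y : Y.val W} (hy : Y.act h y = y) :
    coendMk V' W φ (X.act g x) y = coendMk V W (DivCat.tensorHom g h ≫ φ) x y := by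
  rw [← coendMk_act, hy]

lemma coendMk_act_incl {X Y : SPF k d} {U V : DivCat k d}
    (φ : V.tensor (DivCat.free k d d) ⟶ U) (x : X.val V) {y : Y.val (DivCat.free k d d)}
    (hy : Y.act (DivCat.ofTensor (DivCat.std k d)) y = y) :
    coendMk _ _ (V.tensorMul ≫ φ) (X.act V.incl x) y = coendMk V _ φ x y := by
  rw [coendMk_act_left _ _ _ hy, ← Category.assoc, DivCat.incl_tensorMul,
    ← coendMk_act_left _ _ _ hy, X.act_id]

lemma coendMk_act_ofTensor_tmul {X Y : SPF k d} {U V : DivCat k d}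
    (φ : V.tensor (DivCat.free k d d) ⟶ U) (t : V.T) (x : X.val (DivCat.free k d d))
    {y : Y.val (DivCat.free k d d)} (hy : Y.act (DivCat.ofTensor (DivCat.std k d)) y = y) :
    coendMk _ _ (V.tensorMul ≫ φ)
        (X.act (DivCat.ofTensor (DivCat.tmul t (DivCat.std k d))) x) y =
      coendMk _ _ (DivCat.mul k d ≫ DivCat.ofTensor
        (DivCat.tact φ (DivCat.tmul t (DivCat.std k d)))) x y := by
  rw [coendMk_act_left _ _ _ hy, ← Category.assoc, DivCat.ofTensor_tmul_tensorMul,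
    Category.assoc, DivCat.ofTensor_comp]

/-- Coefficients in `V^{⊗ d}` of the elements of `X(V)`, indexed by `Ω`, on which the permutations
act by the character `ε`, together with elements of `X(k^d)` that are dual to them and generate
`X`. Duality is stated after multiplication by `e₁ ⊗ ⋯ ⊗ e_d` (`mul_base`), which isolates the
coefficient of that tensor; that they generate `X` is asked only for the
images under `DivCat.incl` (`act_incl`), which suffices inside the coend by `coendMk_act_incl`. -/
structure Coefficients (X : SPF k d) (Ω : Type) [Fintype Ω] [DecidableEq Ω]
    [MulAction (Equiv.Perm (Fin d)) Ω] (ε : Equiv.Perm (Fin d) →* k) where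
  coeff : ∀ V, X.val V →ₗ[k] (Ω → V.T)
  base : Ω → X.val (DivCat.free k d d)
  coeff_act : ∀ {V W : DivCat k d} (f : V ⟶ W) (x : X.val V),
    coeff W (X.act f x) = actPi Ω f (coeff V x)
  permPi_coeff : ∀ {V} (σ : Equiv.Perm (Fin d)) (x : X.val V),
    permPi σ (coeff V x) = ε σ • coeff V x
  mul_base : ∀ v w, DivCat.tact (DivCat.mul k d) (DivCat.tmul (coeff _ (base w) v)
    (DivCat.std k d)) = (Pi.single w (DivCat.std k d) : Ω → (DivCat.free k d d).T) v
  act_incl : ∀ {V} (x : X.val V), X.act V.incl x =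
    ∑ w, X.act (DivCat.ofTensor (DivCat.tmul (coeff V x w) (DivCat.std k d))) (base w)

namespace Coefficients

section Product

variable {X Y Z : SPF k d} {Ω Ω' : Type} [Fintype Ω] [DecidableEq Ω]
  [MulAction (Equiv.Perm (Fin d)) Ω] {ε : Equiv.Perm (Fin d) →* k}
  (D : Coefficients X Ω ε)

lemma actPi_mul_outer_base [DecidableEq Ω'] {U : DivCat k d} (u : U.T) (w : Ω) (w' : Ω') :
    actPi _ (DivCat.mul k d ≫ DivCat.ofTensor u)
      (outer (D.coeff _ (D.base w)) (Pi.single w' (DivCat.std k d))) = Pi.single (w, w') u := by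
  rw [actPi_mul_outer_single (D.mul_base · w), DivCat.tact_ofTensor]

lemma coendMk_eq_sum {U V : DivCat k d} (φ : V.tensor (DivCat.free k d d) ⟶ U) (x : X.val V)
    {y : Y.val (DivCat.free k d d)} (hy : Y.act (DivCat.ofTensor (DivCat.std k d)) y = y) :
    coendMk V _ φ x y = ∑ w, coendMk _ _ (DivCat.mul k d ≫ DivCat.ofTensor
      (DivCat.tact φ (DivCat.tmul (D.coeff V x w) (DivCat.std k d)))) (D.base w) y := by
  have h_sum := congrArg ((coendMk _ _ (V.tensorMul ≫ φ)).flip y) (D.act_incl x)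
  rw [map_sum] at h_sum
  refine (coendMk_act_incl φ x hy).symm.trans (h_sum.trans ?_)
  exact Finset.sum_congr rfl fun w _ => coendMk_act_ofTensor_tmul φ _ _ hy

/-- The relations on `k[Ω × Ω'] ⊗ U^{⊗ d}` that hold in the coend because of the relations `R`:
the span of the images of the products of coefficients with elements of `R`. -/
def pairSpan (R : ∀ V : DivCat k d, Submodule k (Ω' → V.T)) (U : DivCat k d) :
    Submodule k (Ω × Ω' → U.T) :=
  Submodule.span k {z | ∃ (V W : DivCat k d) (φ : V.tensor W ⟶ U) (x : X.val V), ∃ y ∈ R W,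
    z = actPi _ φ (outer (D.coeff V x) y)}

section ToCoend

variable [Fintype Ω'] [DecidableEq Ω'] {R : ∀ V : DivCat k d, Submodule k (Ω' → V.T)}
  (P : Presentation Y Ω' R) {U V W : DivCat k d}

/-- The map from `k[Ω × Ω'] ⊗ U^{⊗ d}` to the coend that takes `w ⊗ w' ⊗ u` to the class of the
base elements at `w` and `w'`. -/
def toCoend (U : DivCat k d) : (Ω × Ω' → U.T) →ₗ[k] Coend X Y U :=
  LinearMap.lsum k _ k fun p =>
    ((coendMk _ _).flip (D.base p.1)).flip (P.proj _ (Pi.single p.2 (DivCat.std k d))) ∘ₗ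
      Linear.leftComp k _ (DivCat.mul k d) ∘ₗ DivCat.ofTensor

lemma toCoend_single (w : Ω) (w' : Ω') (u : U.T) :
    D.toCoend P U (Pi.single (w, w') u) = coendMk _ _ (DivCat.mul k d ≫ DivCat.ofTensor u)
      (D.base w) (P.proj _ (Pi.single w' (DivCat.std k d))) :=
  LinearMap.lsum_piSingle _ _ _ _ _ _

lemma toCoend_actPi_outer (φ : V.tensor W ⟶ U) (x : X.val V) (y : Ω' → W.T) :
    D.toCoend P U (actPi _ φ (outer (D.coeff V x) y)) = coendMk V W φ x (P.proj W y) := by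
  suffices h : D.toCoend P U ∘ₗ actPi _ φ ∘ₗ outer (D.coeff V x) =
      coendMk V W φ x ∘ₗ P.proj W from LinearMap.congr_fun h y
  refine LinearMap.pi_ext fun w' t => ?_
  have h_std : coendMk V W φ x (P.proj W (Pi.single w' t)) =
      coendMk V _ (DivCat.tensorHom (𝟙 V) (DivCat.ofTensor t) ≫ φ) x
        (P.proj _ (Pi.single w' (DivCat.std k d))) := by
    rw [← coendMk_act, X.act_id, P.act_ofTensor]
  have h_tact : ∀ s : V.T, DivCat.tact (DivCat.tensorHom (𝟙 V) (DivCat.ofTensor t) ≫ φ)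
      (DivCat.tmul s (DivCat.std k d)) = DivCat.tact φ (DivCat.tmul s t) := fun s => by
    rw [DivCat.tact_comp, DivCat.tact_tensorHom, DivCat.tact_id, DivCat.tact_ofTensor]
  rw [LinearMap.comp_apply, LinearMap.comp_apply, LinearMap.comp_apply, h_std,
    D.coendMk_eq_sum _ _ (P.act_ofTensor _ _), outer_single, map_sum, map_sum]
  simp only [h_tact, actPi_single, toCoend_single]

lemma toCoend_surjective (U : DivCat k d) : Function.Surjective (D.toCoend P U) := fun c => by
  refine mem_of_coendMk_mem (S := LinearMap.range (D.toCoend P U)) (fun V W φ x y => ?_) c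
  obtain ⟨y, rfl⟩ := P.surjective W y
  exact ⟨_, D.toCoend_actPi_outer P φ x y⟩

lemma pairSpan_le_ker_toCoend (U : DivCat k d) :
    D.pairSpan R U ≤ LinearMap.ker (D.toCoend P U) := by
  refine Submodule.span_le.2 ?_
  rintro _ ⟨V, W, φ, x, y, hy, rfl⟩
  rw [SetLike.mem_coe, LinearMap.mem_ker, toCoend_actPi_outer, P.proj_eq_zero.2 hy, map_zero]

end ToCoend

lemma nonempty_internalTensor_iso [Finite Ω'] {R : ∀ V : DivCat k d, Submodule k (Ω' → V.T)}
    {S : ∀ V : DivCat k d, Submodule k (Ω × Ω' → V.T)}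
    (P : Presentation Y Ω' R) (Q : Presentation Z (Ω × Ω') S)
    (hRS : ∀ (V W : DivCat k d) (x : X.val V), ∀ y ∈ R W, outer (D.coeff V x) y ∈ S (V.tensor W))
    (hS : ∀ U, S U ≤ D.pairSpan R U) : Nonempty (internalTensor X Y ≅ Z) := by
  classical
  cases nonempty_fintype Ω'
  let b (V W : DivCat k d) : X.val V →ₗ[k] Y.val W →ₗ[k] Z.val (V.tensor W) :=
    (P.desc ((outer ∘ₗ D.coeff V).compr₂ (Q.proj _)).flip fun y hy => LinearMap.ext fun x =>
      Q.proj_eq_zero.2 (hRS V W x y hy)).flip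
  have b_proj : ∀ V W x y, b V W x (P.proj W y) = Q.proj _ (outer (D.coeff V x) y) :=
    fun V W x y => LinearMap.congr_fun (P.desc_proj _ _ y) x
  have b_natural : ∀ {V V' W W' : DivCat k d} (g : V ⟶ V') (h : W ⟶ W') (x : X.val V)
      (y : Y.val W), Z.act (DivCat.tensorHom g h) (b V W x y) =
        b V' W' (X.act g x) (Y.act h y) := by
    intro V V' W W' g h x y
    obtain ⟨y, rfl⟩ := P.surjective W y
    rw [b_proj, Q.act_proj, P.act_proj, b_proj, D.coeff_act, actPi_outer]
  have desc_toCoend : ∀ U z, coendDesc b b_natural U (D.toCoend P U z) = Q.proj U z := by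
    intro U z
    suffices h : coendDesc b b_natural U ∘ₗ D.toCoend P U = Q.proj U from LinearMap.congr_fun h z
    refine LinearMap.pi_ext fun p u => ?_
    rw [LinearMap.comp_apply, ← D.actPi_mul_outer_base u p.1 p.2, toCoend_actPi_outer,
      coendDesc_mk, b_proj, Q.act_proj]
  refine ⟨internalTensorIso b b_natural fun U => ⟨?_, fun z => ?_⟩⟩
  · refine (injective_iff_map_eq_zero _).2 fun c hc => ?_
    obtain ⟨z, rfl⟩ := D.toCoend_surjective P U c
    rw [desc_toCoend, Q.proj_eq_zero] at hc
    exact D.pairSpan_le_ker_toCoend P U (hS U hc)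
  · obtain ⟨z, rfl⟩ := Q.surjective U z
    exact ⟨_, desc_toCoend U z⟩

end Product

section OfPresentation

variable {X : SPF k d} {Ω : Type} [MulAction (Equiv.Perm (Fin d)) Ω] {ε : Equiv.Perm (Fin d) →* k}
  {R : ∀ V : DivCat k d, Submodule k (Ω → V.T)}

lemma mul_averaging_single [DecidableEq Ω] (v w : Ω) :
    DivCat.tact (DivCat.mul k d) (DivCat.tmul
      (averaging ε (Pi.single w (DivCat.std k d)) v) (DivCat.std k d)) =
        (Pi.single w (DivCat.std k d) : Ω → (DivCat.free k d d).T) v := by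
  have h_ne : ∀ σ : Equiv.Perm (Fin d), σ ≠ 1 → DivCat.tact (DivCat.mul k d) (DivCat.tmul
      (permPi σ (Pi.single w (DivCat.std k d) : Ω → _) v) (DivCat.std k d)) = 0 := fun σ hσ => by
    rw [permPi_single]
    rcases eq_or_ne v (σ • w) with rfl | hv
    · rw [Pi.single_eq_same, DivCat.perm_word, DivCat.tact_mul_word, if_neg]
      exact fun h => hσ (inv_eq_one.1 (DFunLike.coe_injective h))
    · rw [Pi.single_eq_of_ne hv, map_zero, LinearMap.zero_apply, map_zero]
  rw [averaging_apply, Finset.sum_apply, map_sum, LinearMap.sum_apply, map_sum,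
    Finset.sum_eq_single_of_mem 1 (Finset.mem_univ _) fun σ _ hσ => ?_]
  · rw [permPi_one, inv_one, map_one, one_smul]
    rcases eq_or_ne v w with rfl | hv
    · rw [Pi.single_eq_same, DivCat.tact_mul_word, if_pos rfl]
    · rw [Pi.single_eq_of_ne hv, map_zero, LinearMap.zero_apply, map_zero]
  · rw [Pi.smul_apply, LinearMap.map_smul₂, map_smul, h_ne σ hσ, smul_zero]

lemma actPi_incl_sub_mem_charRel {V : DivCat k d} (z : Ω → V.T) :
    (actPi Ω V.incl z - fun w => DivCat.tmul (averaging ε z w) (DivCat.std k d)) ∈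
      charRel Ω ε (V.tensor (DivCat.free k d d)) := by
  let y (σ : Equiv.Perm (Fin d)) : Ω → (V.tensor (DivCat.free k d d)).T :=
    fun w => DivCat.tmul (z w) (perm k σ⁻¹ (DivCat.std k d))
  have h_incl : actPi Ω V.incl z = ∑ σ, y σ := by
    ext w : 1
    rw [Finset.sum_apply, actPi_apply, DivCat.tact_incl]
    exact (Equiv.sum_comp (Equiv.inv _) _).symm
  have h_permPi : ∀ σ, permPi σ (y σ) = fun w => DivCat.tmul (permPi σ z w) (DivCat.std k d) := by
    refine fun σ => funext fun w => ?_
    rw [permPi_apply, DivCat.perm_tmul, ← perm_mul, mul_inv_cancel, perm_one]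
    rfl
  have h_averaging : (fun w => DivCat.tmul (averaging ε z w) (DivCat.std k d)) =
      ∑ σ, ε σ⁻¹ • permPi σ (y σ) := by
    ext w : 1
    simp only [averaging_apply, Finset.sum_apply, map_sum, LinearMap.sum_apply, Pi.smul_apply,
      LinearMap.map_smul₂, h_permPi]
  rw [h_incl, h_averaging, ← Finset.sum_sub_distrib]
  refine Submodule.sum_mem _ fun σ _ => ?_
  have h := Submodule.smul_mem _ (ε σ⁻¹) (permPi_sub_mem_charRel (ε := ε) σ (y σ))
  rw [smul_sub, smul_smul, ← map_mul, inv_mul_cancel, map_one, one_smul] at h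
  rw [← neg_sub]
  exact neg_mem h

variable [Fintype Ω] [DecidableEq Ω]

/-- The coefficients of a functor presented by relations that imply `σ z ∼ ε(σ) z` and are killed
by averaging. -/
def ofPresentation (P : Presentation X Ω R) (hR : ∀ V, charRel Ω ε V ≤ R V)
    (havg : ∀ V, R V ≤ LinearMap.ker (averaging ε)) : Coefficients X Ω ε where
  coeff V := P.desc (averaging ε) (havg V)
  base w := P.proj _ (Pi.single w (DivCat.std k d))
  coeff_act {V W} f x := by
    obtain ⟨z, rfl⟩ := P.surjective V x
    rw [P.act_proj, P.desc_proj, P.desc_proj, actPi_averaging]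
  permPi_coeff {V} σ x := by
    obtain ⟨z, rfl⟩ := P.surjective V x
    rw [P.desc_proj, permPi_averaging]
  mul_base v w := by rw [P.desc_proj, mul_averaging_single]
  act_incl {V} x := by
    obtain ⟨z, rfl⟩ := P.surjective V x
    simp only [P.act_ofTensor, P.desc_proj]
    rw [← map_sum, Finset.univ_sum_single, P.act_proj, ← sub_eq_zero, ← map_sub,
      P.proj_eq_zero]
    exact hR _ (actPi_incl_sub_mem_charRel z)

lemma ofPresentation_coeff (P : Presentation X Ω R) (hR : ∀ V, charRel Ω ε V ≤ R V)
    (havg : ∀ V, R V ≤ LinearMap.ker (averaging ε)) {V : DivCat k d} (z : Ω → V.T) :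
    (ofPresentation P hR havg).coeff V (P.proj V z) = averaging ε z :=
  P.desc_proj _ (havg V) z

end OfPresentation

section PairSpan

variable {X : SPF k d} {Ω Ω' : Type} [Fintype Ω] [DecidableEq Ω] [MulAction (Equiv.Perm (Fin d)) Ω]
  {ε : Equiv.Perm (Fin d) →* k} (D : Coefficients X Ω ε)
  [MulAction (Equiv.Perm (Fin d)) Ω'] {ε' : Equiv.Perm (Fin d) →* k}
  {R : ∀ V : DivCat k d, Submodule k (Ω' → V.T)}

lemma charRel_le_pairSpan [Finite Ω'] (hR : ∀ V, charRel Ω' ε' V ≤ R V) (U : DivCat k d) :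
    charRel (Ω × Ω') (ε * ε') U ≤ D.pairSpan R U := by
  classical
  refine charRel_le_iff.2 fun σ w u => ?_
  let φ := DivCat.mul k d ≫ DivCat.ofTensor u
  let c := D.coeff _ (D.base w.1)
  let y : Ω' → (DivCat.free k d d).T := Pi.single w.2 (DivCat.std k d)
  have h_single : Pi.single w u = actPi _ φ (outer c y) := (D.actPi_mul_outer_base u w.1 w.2).symm
  have h_permPi : permPi σ (Pi.single w u) = ε σ • actPi _ φ (outer c (permPi σ y)) := by
    rw [h_single, ← actPi_permPi, permPi_outer, D.permPi_coeff, LinearMap.map_smul₂, map_smul]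
  have h_sub : permPi σ (Pi.single w u) - (ε * ε') σ • (Pi.single w u : Ω × Ω' → U.T) =
      ε σ • actPi _ φ (outer c (permPi σ y - ε' σ • y)) := by
    rw [h_permPi, h_single, map_sub, map_sub, map_smul, map_smul, smul_sub, smul_smul,
      MonoidHom.mul_apply]
  rw [← permPi_single, h_sub]
  exact Submodule.smul_mem _ _ (Submodule.subset_span
    ⟨_, _, φ, _, _, hR _ (permPi_sub_mem_charRel σ y), rfl⟩)

lemma diagRel_le_pairSpan [DecidableEq Ω'] (hR : ∀ V, diagRel Ω' V ≤ R V)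
    (hD : ∀ (i j : Fin d) (w : Ω), Equiv.swap i j • w = w →
      ∃ x : X.val (DivCat.free k d d), ∀ v, DivCat.tact (DivCat.mul k d)
        (DivCat.tmul (D.coeff _ x v) (DivCat.word k (Function.update id j i))) =
          (Pi.single w (DivCat.word k (Function.update id j i)) : Ω → (DivCat.free k d d).T) v)
    (U : DivCat k d) : diagRel (Ω × Ω') U ≤ D.pairSpan R U := by
  refine Submodule.span_le.2 ?_
  rintro _ ⟨i, j, ⟨w, w'⟩, x, hij, hw, hx, rfl⟩
  obtain ⟨s, hs⟩ := hD i j w (congrArg Prod.fst hw)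
  have h_update : x ∘ Function.update id j i = x := by
    rw [Function.comp_update, Function.comp_id, hx, Function.update_eq_self]
  have h_mem : Pi.single w' (DivCat.word k (Function.update id j i)) ∈
      R (DivCat.free k d d) :=
    hR _ <| Submodule.subset_span ⟨i, j, w', _, hij, congrArg Prod.snd hw, by
      rw [Function.update_of_ne hij, Function.update_self, id], rfl⟩
  have h_single := actPi_mul_outer_single hs (DivCat.ofVectors x) w'
  rw [DivCat.tact_ofVectors, h_update] at h_single
  rw [SetLike.mem_coe, ← h_single]
  exact Submodule.subset_span ⟨_, _, _, s, _, h_mem, rfl⟩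

end PairSpan

end Coefficients

end SPF

/-! ## Words of a given weight -/

section Words

variable {n m : ℕ}

/-- The words of length `d` in which the letter `i` occurs `l i` times. They form an `S_d`-set
isomorphic to `S_d / S_l`. -/
def Words (l : Weight n d) : Type :=
  {w : Fin d → Fin n // ∀ i, (Finset.univ.filter fun p => w p = i).card = l.1 i}

instance (l : Weight n d) : Fintype (Words l) := inferInstanceAs (Fintype (Subtype _))

instance (l : Weight n d) : DecidableEq (Words l) := inferInstanceAs (DecidableEq (Subtype _))

instance (l : Weight n d) : MulAction (Equiv.Perm (Fin d)) (Words l) where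
  smul σ w := ⟨w.1 ∘ σ.symm, fun i => by
    rw [← w.2 i]
    exact Finset.card_equiv σ.symm (by simp)⟩
  one_smul _ := rfl
  mul_smul _ _ _ := rfl

namespace Words

variable {l : Weight n d}

lemma smul_val (σ : Equiv.Perm (Fin d)) (w : Words l) : (σ • w).1 = w.1 ∘ σ.symm := rfl

lemma swap_smul_eq_iff {w : Words l} {i j : Fin d} :
    Equiv.swap i j • w = w ↔ w.1 i = w.1 j := by
  refine ⟨fun h => ?_, fun h => Subtype.ext ?_⟩
  · have hj := congrFun (congrArg Subtype.val h) j
    rwa [smul_val, Function.comp_apply, Equiv.symm_swap, Equiv.swap_apply_right] at hj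
  · rw [smul_val, Equiv.symm_swap, Equiv.comp_swap_eq_update, h, Function.update_eq_self,
      ← h, Function.update_eq_self]

end Words

/-- The word of the blocks of a weight. -/
def blockWord (l : Weight n d) : Words l := ⟨l.block, fun i => by
  rw [← Fintype.card_subtype]
  have e : {j : Fin d // l.block j = i} ≃ {s : Σ i, Fin (l.1 i) // s.1 = i} :=
    ((finCongr l.2.symm).trans finSigmaFinEquiv.symm).subtypeEquiv fun _ => Iff.rfl
  rw [Fintype.card_congr (e.trans (Equiv.sigmaSubtype i)), Fintype.card_fin]⟩

lemma smul_blockWord_eq_iff {l : Weight n d} {σ : Equiv.Perm (Fin d)} :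
    σ • blockWord l = blockWord l ↔ σ ∈ l.young := by
  refine Subtype.ext_iff.trans ?_
  rw [Words.smul_val, Equiv.comp_symm_eq, eq_comm]
  exact funext_iff

lemma exists_smul_blockWord_eq {l : Weight n d} (w : Words l) :
    ∃ σ : Equiv.Perm (Fin d), σ • blockWord l = w := by
  have h : ∀ i, Nonempty ({p // l.block p = i} ≃ {p // w.1 p = i}) := fun i =>
    Fintype.card_eq.1 <| by
      rw [Fintype.card_subtype, Fintype.card_subtype, w.2 i]
      exact (blockWord l).2 i
  refine ⟨Equiv.ofFiberEquiv fun i => (h i).some, Subtype.ext ?_⟩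
  rw [Words.smul_val, Equiv.comp_symm_eq]
  exact funext fun p => (Equiv.ofFiberEquiv_map _ p).symm

/-- A permutation that takes the word of the blocks to a given word. -/
def toWord {l : Weight n d} (w : Words l) : Equiv.Perm (Fin d) :=
  (exists_smul_blockWord_eq w).choose

lemma toWord_smul {l : Weight n d} (w : Words l) : toWord w • blockWord l = w :=
  (exists_smul_blockWord_eq w).choose_spec

lemma toWord_inv_mul_mem_young {l : Weight n d} {w : Words l} {σ : Equiv.Perm (Fin d)}
    (h : σ • blockWord l = w) : (toWord w)⁻¹ * σ ∈ l.young := by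
  rw [← smul_blockWord_eq_iff, mul_smul, h, inv_smul_eq_iff, toWord_smul]

section Matrices

variable {c : Weight m d} {r : Weight n d}

lemma card_filter_fst_eq (u : Fin d → Fin n × Fin m) (i : Fin n) :
    (Finset.univ.filter fun p => (u p).1 = i).card =
      ∑ j, (Finset.univ.filter fun p => u p = (i, j)).card := by
  rw [Finset.card_eq_sum_card_fiberwise (f := fun p => (u p).2) (t := Finset.univ)
    fun _ _ => Finset.mem_univ _]
  simp only [Finset.filter_filter, Prod.ext_iff]

lemma card_filter_snd_eq (u : Fin d → Fin n × Fin m) (j : Fin m) :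
    (Finset.univ.filter fun p => (u p).2 = j).card =
      ∑ i, (Finset.univ.filter fun p => u p = (i, j)).card := by
  rw [Finset.card_eq_sum_card_fiberwise (f := fun p => (u p).1) (t := Finset.univ)
    fun _ _ => Finset.mem_univ _]
  simp only [Finset.filter_filter, Prod.ext_iff, and_comm]

/-- The matrix entries that a word of the weight `ofMatrix A` runs through. -/
def entries {A : Weight.Matrices r c} (v : Words (Weight.ofMatrix A)) (p : Fin d) :
    Fin n × Fin m := finProdFinEquiv.symm (v.1 p)

lemma card_filter_entries_eq {A : Weight.Matrices r c} (v : Words (Weight.ofMatrix A)) (i : Fin n)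
    (j : Fin m) : (Finset.univ.filter fun p => entries v p = (i, j)).card = A.1 i j := by
  simpa only [entries, Equiv.symm_apply_eq, Weight.ofMatrix, Equiv.symm_apply_apply]
    using v.2 (finProdFinEquiv (i, j))

/-- The words of the columns and of the rows of the entries of a word. -/
def splitWord (c : Weight m d) (r : Weight n d)
    (v : Σ A : Weight.Matrices r c, Words (Weight.ofMatrix A)) : Words c × Words r :=
  (⟨fun p => (entries v.2 p).2, fun j => by
      simp only [card_filter_snd_eq, card_filter_entries_eq, v.1.2.2 j]⟩,
   ⟨fun p => (entries v.2 p).1, fun i => by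
      simp only [card_filter_fst_eq, card_filter_entries_eq, v.1.2.1 i]⟩)

lemma splitWord_injective : Function.Injective (splitWord c r) := by
  rintro ⟨A, v⟩ ⟨B, w⟩ h
  have h_entries : entries v = entries w := funext fun p => Prod.ext
    (congrFun (congrArg Subtype.val (congrArg Prod.snd h)) p)
    (congrFun (congrArg Subtype.val (congrArg Prod.fst h)) p)
  obtain rfl : A = B := Subtype.ext <| Matrix.ext fun i j => by
    rw [← card_filter_entries_eq v, h_entries, card_filter_entries_eq w]
  obtain rfl : v = w := Subtype.ext <| funext fun p =>
    finProdFinEquiv.symm.injective (congrFun h_entries p)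
  rfl

lemma splitWord_surjective : Function.Surjective (splitWord c r) := by
  rintro ⟨w, w'⟩
  let u (p : Fin d) : Fin n × Fin m := (w'.1 p, w.1 p)
  let A : Weight.Matrices r c :=
    ⟨fun i j => (Finset.univ.filter fun p => u p = (i, j)).card,
      fun i => (card_filter_fst_eq u i).symm.trans (w'.2 i),
      fun j => (card_filter_snd_eq u j).symm.trans (w.2 j)⟩
  let v : Words (Weight.ofMatrix A) := ⟨fun p => finProdFinEquiv (u p), fun i => by
    simp only [← Equiv.eq_symm_apply]
    rfl⟩
  have h_entries : ∀ p, entries v p = u p := fun p => Equiv.symm_apply_apply _ _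
  exact ⟨⟨A, v⟩, Prod.ext (Subtype.ext (funext fun p => congrArg Prod.snd (h_entries p)))
    (Subtype.ext (funext fun p => congrArg Prod.fst (h_entries p)))⟩

/-- A pair of words is a word in the entries of a matrix with prescribed row and column sums. -/
def splitEquiv (c : Weight m d) (r : Weight n d) :
    (Σ A : Weight.Matrices r c, Words (Weight.ofMatrix A)) ≃ Words c × Words r :=
  Equiv.ofBijective _ ⟨splitWord_injective, splitWord_surjective⟩

lemma splitEquiv_smul (σ : Equiv.Perm (Fin d)) (A : Weight.Matrices r c)
    (v : Words (Weight.ofMatrix A)) :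
    splitEquiv c r ⟨A, σ • v⟩ = σ • splitEquiv c r ⟨A, v⟩ := rfl

instance (c : Weight m d) (r : Weight n d) : Finite (Weight.Matrices r c) :=
  Finite.of_surjective (fun x => ((splitEquiv c r).symm x).1) fun A =>
    ⟨splitEquiv c r ⟨A, blockWord _⟩, congrArg Sigma.fst (Equiv.symm_apply_apply _ _)⟩

end Matrices

end Words

/-! ## Presentations by words -/

namespace SPF

section WordPresentation

variable {n : ℕ} {l : Weight n d} {ε : Equiv.Perm (Fin d) →* k} {V W : DivCat k d}

/-- The map to the tensor power that moves every word to the word of the blocks, which brings a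
family of tensors to the normal form `single (blockWord l) t` modulo `charRel (Words l) ε V`. -/
def toBlock (l : Weight n d) (ε : Equiv.Perm (Fin d) →* k) : (Words l → V.T) →ₗ[k] V.T :=
  ∑ w : Words l, ε (toWord w) • perm k (toWord w)⁻¹ ∘ₗ LinearMap.proj w

lemma toBlock_single (w : Words l) (t : V.T) :
    toBlock l ε (Pi.single w t) = ε (toWord w) • perm k (toWord w)⁻¹ t := by
  rw [toBlock, LinearMap.sum_apply, Finset.sum_eq_single_of_mem w (Finset.mem_univ w)
    fun v _ hv => ?_]
  · rw [LinearMap.smul_apply, LinearMap.comp_apply, LinearMap.proj_apply, Pi.single_eq_same]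
  · rw [LinearMap.smul_apply, LinearMap.comp_apply, LinearMap.proj_apply, Pi.single_eq_of_ne hv,
      map_zero, smul_zero]

lemma tact_toBlock (f : V ⟶ W) (z : Words l → V.T) :
    DivCat.tact f (toBlock l ε z) = toBlock l ε (actPi _ f z) := by
  suffices h : DivCat.tact f ∘ₗ toBlock l ε = toBlock l ε ∘ₗ actPi _ f from
    LinearMap.congr_fun h z
  refine LinearMap.pi_ext fun w t => ?_
  rw [LinearMap.comp_apply, LinearMap.comp_apply, actPi_single, toBlock_single, toBlock_single,
    map_smul, DivCat.perm_tact]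

lemma sub_single_toBlock_mem_charRel (z : Words l → V.T) :
    z - Pi.single (blockWord l) (toBlock l ε z) ∈ charRel (Words l) ε V := by
  suffices h : (charRel (Words l) ε V).mkQ ∘ₗ (LinearMap.id -
      LinearMap.single k (fun _ => V.T) (blockWord l) ∘ₗ toBlock l ε) = 0 from
    (Submodule.Quotient.mk_eq_zero _).1 (LinearMap.congr_fun h z)
  refine LinearMap.pi_ext fun w t => (Submodule.Quotient.mk_eq_zero _).2 ?_
  have h := permPi_sub_mem_charRel (ε := ε) (toWord w)
    (Pi.single (blockWord l) (perm k (toWord w)⁻¹ t))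
  rw [permPi_single, toWord_smul, ← perm_mul, mul_inv_cancel, perm_one, ← Pi.single_smul] at h
  rw [LinearMap.sub_apply, LinearMap.comp_apply, toBlock_single]
  exact h

variable {N : Type*} [AddCommGroup N] [Module k N] {q : V.T →ₗ[k] N}

lemma map_toBlock_single (hq : ∀ σ ∈ l.young, ∀ t, q (perm k σ t) = ε σ • q t) {w : Words l}
    {σ : Equiv.Perm (Fin d)} (hσ : σ • blockWord l = w) (t : V.T) :
    q (toBlock l ε (Pi.single w t)) = ε σ • q (perm k σ⁻¹ t) := by
  have h := hq _ (toWord_inv_mul_mem_young hσ) (perm k σ⁻¹ t)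
  rw [← perm_mul, mul_inv_cancel_right] at h
  rw [toBlock_single, map_smul, h, smul_smul, ← map_mul, mul_inv_cancel_left]

lemma charRel_le_ker_toBlock (hq : ∀ σ ∈ l.young, ∀ t, q (perm k σ t) = ε σ • q t) :
    charRel (Words l) ε V ≤ LinearMap.ker (q ∘ₗ toBlock l ε) := by
  refine charRel_le_iff.2 fun σ w t => ?_
  have h_smul : (σ * toWord w) • blockWord l = σ • w := by rw [mul_smul, toWord_smul]
  rw [LinearMap.mem_ker, LinearMap.comp_apply, map_sub, map_sub, map_smul, map_smul,
    map_toBlock_single hq (toWord_smul w), map_toBlock_single hq h_smul, smul_smul, ← map_mul,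
    mul_inv_rev, perm_mul, ← perm_mul σ⁻¹, inv_mul_cancel, perm_one, LinearMap.id_apply, sub_self]

/-- The presentation by words of a quotient of the tensor power. -/
def Presentation.ofTensorPower {Y : SPF k d} {R : ∀ V : DivCat k d, Submodule k (Words l → V.T)}
    (q : ∀ V : DivCat k d, V.T →ₗ[k] Y.val V) (hsurj : ∀ V, Function.Surjective (q V))
    (hact : ∀ {V W : DivCat k d} (f : V ⟶ W) (t : V.T),
      Y.act f (q V t) = q W (DivCat.tact f t))
    (hq : ∀ V, ∀ σ ∈ l.young, ∀ t, q V (perm k σ t) = ε σ • q V t)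
    (hR : ∀ V, charRel (Words l) ε V ≤ R V)
    (hker : ∀ V t, q V t = 0 → Pi.single (blockWord l) t ∈ R V)
    (hRq : ∀ V, R V ≤ LinearMap.ker (q V ∘ₗ toBlock l ε)) :
    Presentation Y (Words l) R where
  proj V := q V ∘ₗ toBlock l ε
  surjective V y := by
    obtain ⟨t, rfl⟩ := hsurj V y
    refine ⟨Pi.single (blockWord l) t, ?_⟩
    rw [LinearMap.comp_apply, map_toBlock_single (hq V) (one_smul _ _), map_one, one_smul,
      inv_one, perm_one, LinearMap.id_apply]
  proj_eq_zero {V z} := by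
    refine ⟨fun h => ?_, fun h => hRq V h⟩
    have h_mem := add_mem (hR V (sub_single_toBlock_mem_charRel z)) (hker V _ h)
    rwa [sub_add_cancel] at h_mem
  act_proj f z := by rw [LinearMap.comp_apply, hact, tact_toBlock, LinearMap.comp_apply]

end WordPresentation

section SymmWedge

variable {n : ℕ} {l : Weight n d}

lemma mkQ_symRel_perm {M : Type u} [AddCommGroup M] [Module k M] {σ : Equiv.Perm (Fin d)}
    (hσ : σ ∈ l.young) (t : TPow k d M) :
    (symRel k l M).mkQ (perm k σ t) = (symRel k l M).mkQ t :=
  (Submodule.Quotient.eq _).2 (Submodule.subset_span ⟨σ, hσ, t, rfl⟩)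

lemma single_blockWord_mem_charRel {V : DivCat k d} {t : V.T} (ht : t ∈ symRel k l V.carrier) :
    Pi.single (blockWord l) t ∈ charRel (Words l) (1 : Equiv.Perm (Fin d) →* k) V := by
  suffices h : symRel k l V.carrier ≤ (charRel (Words l) 1 V).comap
    (LinearMap.single k (fun _ => V.T) (blockWord l)) from h ht
  refine Submodule.span_le.2 ?_
  rintro _ ⟨σ, hσ, s, rfl⟩
  have h := permPi_sub_mem_charRel (ε := (1 : Equiv.Perm (Fin d) →* k)) σ
    (Pi.single (blockWord l) s : Words l → V.T)
  rwa [permPi_single, smul_blockWord_eq_iff.2 hσ, MonoidHom.one_apply, one_smul,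
    ← Pi.single_sub] at h

/-- The presentation of `Sym^l` by words. -/
def symmPresentation (k : Type u) [CommRing k] (l : Weight n d) :
    Presentation (Symm k l) (Words l) (charRel (Words l) (1 : Equiv.Perm (Fin d) →* k)) :=
  have hq : ∀ V : DivCat k d, ∀ σ ∈ l.young, ∀ t : V.T, (symRel k l V.carrier).mkQ (perm k σ t) =
      (1 : Equiv.Perm (Fin d) →* k) σ • (symRel k l V.carrier).mkQ t := fun V σ hσ t => by
    rw [mkQ_symRel_perm hσ, MonoidHom.one_apply, one_smul]
  .ofTensorPower (fun V => (symRel k l V.carrier).mkQ) (fun _ => Submodule.mkQ_surjective _)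
    (fun _ _ => rfl) hq (fun _ => le_rfl)
    (fun _ _ ht => single_blockWord_mem_charRel ((Submodule.Quotient.mk_eq_zero _).1 ht))
    (fun V => charRel_le_ker_toBlock (hq V))

lemma young_eq_closure_swap (l : Weight n d) :
    l.young = Subgroup.closure {τ | ∃ i j, i ≠ j ∧ l.block i = l.block j ∧ τ = Equiv.swap i j} := by
  refine le_antisymm (fun σ hσ => ?_) ((Subgroup.closure_le _).2 ?_)
  · refine (mem_closure_isSwap ?_).2 ⟨Set.toFinite _, fun p => ?_⟩
    · rintro _ ⟨i, j, hij, -, rfl⟩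
      exact ⟨i, j, hij, rfl⟩
    · by_cases hp : p = σ p
      · rw [← hp]
        exact MulAction.mem_orbit_self p
      · exact ⟨⟨Equiv.swap p (σ p), Subgroup.subset_closure ⟨p, σ p, hp, (hσ p).symm, rfl⟩⟩,
          Equiv.swap_apply_left _ _⟩
  · rintro _ ⟨i, j, -, hb, rfl⟩
    exact smul_blockWord_eq_iff.1 (Words.swap_smul_eq_iff.2 hb)

lemma mkQ_altRel_perm_swap {M : Type u} [AddCommGroup M] [Module k M] {i j : Fin d} (hij : i ≠ j)
    (hb : l.block i = l.block j) (t : TPow k d M) :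
    (altRel k l M).mkQ (perm k (Equiv.swap i j) t) = -(altRel k l M).mkQ t := by
  have hle : altPair k i j M ≤ altRel k l M := by
    refine Submodule.span_le.2 ?_
    rintro _ ⟨y, hy, rfl⟩
    exact Submodule.subset_span ⟨i, j, y, hij, hb, hy, rfl⟩
  suffices h : (altRel k l M).mkQ ∘ₗ perm k (Equiv.swap i j) = -(altRel k l M).mkQ from
    LinearMap.congr_fun h t
  refine tpow_hom_ext fun x => ?_
  rw [LinearMap.comp_apply, LinearMap.neg_apply, perm_tprod, Equiv.symm_swap,
    eq_neg_iff_add_eq_zero, add_comm, ← map_add]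
  exact (Submodule.Quotient.mk_eq_zero _).2 (hle (altPair_add_swap hij x))

lemma mkQ_altRel_perm {M : Type u} [AddCommGroup M] [Module k M] {σ : Equiv.Perm (Fin d)}
    (hσ : σ ∈ l.young) (t : TPow k d M) :
    (altRel k l M).mkQ (perm k σ t) = sgnChar k d σ • (altRel k l M).mkQ t := by
  rw [young_eq_closure_swap] at hσ
  induction hσ using Subgroup.closure_induction_left generalizing t with
  | one => rw [perm_one, map_one, one_smul, LinearMap.id_apply]
  | mul_left τ hτ σ _ ih =>
    obtain ⟨i, j, hij, hb, rfl⟩ := hτ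
    rw [perm_mul, mkQ_altRel_perm_swap hij hb, ih, map_mul, sgnChar_swap hij, neg_one_mul, neg_smul]
  | inv_mul_cancel τ hτ σ _ ih =>
    obtain ⟨i, j, hij, hb, rfl⟩ := hτ
    rw [Equiv.swap_inv, perm_mul, mkQ_altRel_perm_swap hij hb, ih, map_mul, sgnChar_swap hij,
      neg_one_mul, neg_smul]

lemma single_blockWord_mem_diagRel {V : DivCat k d} {t : V.T} (ht : t ∈ altRel k l V.carrier) :
    Pi.single (blockWord l) t ∈ diagRel (Words l) V := by
  suffices h : altRel k l V.carrier ≤ (diagRel (Words l) V).comap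
    (LinearMap.single k (fun _ => V.T) (blockWord l)) from h ht
  refine Submodule.span_le.2 ?_
  rintro _ ⟨i, j, x, hij, hb, hx, rfl⟩
  exact Submodule.subset_span ⟨i, j, _, x, hij, Words.swap_smul_eq_iff.2 hb, hx, rfl⟩

lemma diagRel_le_ker_toBlock (V : DivCat k d) : diagRel (Words l) V ≤
    LinearMap.ker ((altRel k l V.carrier).mkQ ∘ₗ toBlock l (sgnChar k d)) := by
  refine Submodule.span_le.2 ?_
  rintro _ ⟨i, j, w, x, hij, hw, hx, rfl⟩
  have hb : l.block ((toWord w)⁻¹ i) = l.block ((toWord w)⁻¹ j) := by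
    rw [Words.swap_smul_eq_iff, ← toWord_smul w] at hw
    exact hw
  have h_mem : perm k (toWord w)⁻¹ (PiTensorProduct.tprod k x) ∈ altRel k l V.carrier := by
    rw [perm_tprod]
    exact Submodule.subset_span ⟨(toWord w)⁻¹ i, (toWord w)⁻¹ j, _,
      (toWord w)⁻¹.injective.ne hij, hb, by rwa [Equiv.symm_apply_apply, Equiv.symm_apply_apply],
      rfl⟩
  rw [SetLike.mem_coe, LinearMap.mem_ker, LinearMap.comp_apply, toBlock_single, map_smul,
    Submodule.mkQ_apply, (Submodule.Quotient.mk_eq_zero _).2 h_mem, smul_zero]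

/-- The presentation of `∧^l` by words. -/
def wedgePresentation (k : Type u) [CommRing k] (l : Weight n d) :
    Presentation (Wedge k l) (Words l) (extRel (k := k) (Words l)) :=
  .ofTensorPower (fun V => (altRel k l V.carrier).mkQ) (fun _ => Submodule.mkQ_surjective _)
    (fun _ _ => rfl) (fun _ _ hσ => mkQ_altRel_perm hσ) (fun _ => le_sup_left)
    (fun _ _ ht => Submodule.mem_sup_right <|
      single_blockWord_mem_diagRel ((Submodule.Quotient.mk_eq_zero _).1 ht))
    (fun V => sup_le (charRel_le_ker_toBlock fun _ hσ => mkQ_altRel_perm hσ)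
      (diagRel_le_ker_toBlock V))

end SymmWedge

section Gam

variable {n : ℕ} {l : Weight n d} {V : DivCat k d}

/-- The family of the tensors that an element of `(V^{⊗ d})^{S_l}` yields by permutation of the
places, indexed by `S_d / S_l`. -/
def gamCoeff (l : Weight n d) (V : DivCat k d) : (Gam k l).val V →ₗ[k] (Words l → V.T) :=
  LinearMap.pi fun w => perm k (toWord w) ∘ₗ (invariants k l.young V.carrier).subtype

lemma gamCoeff_eq_perm {σ : Equiv.Perm (Fin d)} {w : Words l} (h : σ • blockWord l = w)
    (x : (Gam k l).val V) : gamCoeff l V x w = perm k σ x.1 := by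
  have hx : perm k ((toWord w)⁻¹ * σ) x.1 = x.1 := x.2 _ (toWord_inv_mul_mem_young h)
  rw [← mul_inv_cancel_left (toWord w) σ, perm_mul, hx]
  rfl

lemma gamCoeff_blockWord (x : (Gam k l).val V) : gamCoeff l V x (blockWord l) = x.1 := by
  rw [gamCoeff_eq_perm (one_smul _ _), perm_one, LinearMap.id_apply]

lemma gamCoeff_injective : Function.Injective (gamCoeff l V) := fun x y h =>
  Subtype.ext <| by rw [← gamCoeff_blockWord, h, gamCoeff_blockWord]

lemma permPi_gamCoeff (σ : Equiv.Perm (Fin d)) (x : (Gam k l).val V) :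
    permPi σ (gamCoeff l V x) = gamCoeff l V x := by
  ext w : 1
  have h : (σ * toWord (σ⁻¹ • w)) • blockWord l = w := by
    rw [mul_smul, toWord_smul, smul_inv_smul]
  rw [permPi_apply, gamCoeff_eq_perm h, perm_mul]
  rfl

lemma gamCoeff_act {W : DivCat k d} (f : V ⟶ W) (x : (Gam k l).val V) :
    gamCoeff l W ((Gam k l).act f x) = actPi (Words l) f (gamCoeff l V x) :=
  funext fun _ => DivCat.perm_tact f _ _

/-- The element of `(V^{⊗ d})^{S_l}` with a given invariant family of permuted tensors. -/
def ofInvariantFamily (z : Words l → V.T) (hz : ∀ σ, permPi σ z = z) : (Gam k l).val V :=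
  ⟨z (blockWord l), fun σ hσ => by
    have h : σ⁻¹ • blockWord l = blockWord l := smul_blockWord_eq_iff.2 (inv_mem hσ)
    conv_rhs => rw [← hz σ, permPi_apply, h]⟩

lemma gamCoeff_ofInvariantFamily {z : Words l → V.T} (hz : ∀ σ, permPi σ z = z) :
    gamCoeff l V (ofInvariantFamily z hz) = z := by
  ext w : 1
  conv_rhs => rw [← hz (toWord w), permPi_apply, inv_smul_eq_iff.2 (toWord_smul w).symm]
  rfl

lemma permPi_averaging_one (z : Words l → V.T) (σ : Equiv.Perm (Fin d)) :
    permPi σ (averaging 1 z) = averaging 1 z := by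
  rw [permPi_averaging, MonoidHom.one_apply, one_smul]

/-- The coefficients of `Γ^l`. -/
def gamCoefficients (k : Type u) [CommRing k] (l : Weight n d) :
    Coefficients (Gam k l) (Words l) 1 where
  coeff := gamCoeff l
  base w := ofInvariantFamily _ (permPi_averaging_one (Pi.single w (DivCat.std k d)))
  coeff_act := gamCoeff_act
  permPi_coeff σ x := by rw [permPi_gamCoeff, MonoidHom.one_apply, one_smul]
  mul_base v w := by rw [gamCoeff_ofInvariantFamily, Coefficients.mul_averaging_single]
  act_incl {V} x := gamCoeff_injective <| by
    have h_perm : ∀ σ, permPi σ (fun w => DivCat.tmul (gamCoeff l V x w) (DivCat.std k d)) =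
        fun w => DivCat.tmul (gamCoeff l V x w) (perm k σ (DivCat.std k d)) := fun σ => by
      ext w : 1
      conv_rhs => rw [← permPi_gamCoeff σ]
      exact DivCat.perm_tmul _ _ _
    simp only [map_sum, gamCoeff_act, gamCoeff_ofInvariantFamily, actPi_averaging, actPi_single,
      DivCat.tact_ofTensor]
    rw [← map_sum, Finset.univ_sum_single, averaging_apply]
    ext w : 1
    simp only [h_perm, MonoidHom.one_apply, one_smul, Finset.sum_apply, actPi_apply,
      DivCat.tact_incl]

/-- The family whose member at `v` is the sum of the tensors `e_{q 1} ⊗ ⋯ ⊗ e_{q d}` of `k^d` with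
`w ∘ q = v`. -/
def pullbackFamily (k : Type u) [CommRing k] (w : Words l) : Words l → (DivCat.free k d d).T :=
  fun v => ∑ q : Fin d → Fin d with w.1 ∘ q = v.1, DivCat.word k q

lemma permPi_pullbackFamily (w : Words l) (σ : Equiv.Perm (Fin d)) :
    permPi σ (pullbackFamily k w) = pullbackFamily k w := by
  ext v : 1
  rw [permPi_apply, pullbackFamily, pullbackFamily, map_sum]
  refine Finset.sum_equiv (σ.arrowCongr (Equiv.refl _)) (fun q => ?_) fun q _ =>
    DivCat.perm_word σ q
  simp only [Finset.mem_filter, Finset.mem_univ, true_and]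
  exact (Equiv.comp_symm_eq σ v.1 (w.1 ∘ q)).symm

lemma mul_pullbackFamily {w : Words l} {g : Fin d → Fin d} (hg : w.1 ∘ g = w.1) (v : Words l) :
    DivCat.tact (DivCat.mul k d) (DivCat.tmul (pullbackFamily k w v) (DivCat.word k g)) =
      (Pi.single w (DivCat.word k g) : Words l → (DivCat.free k d d).T) v := by
  simp only [pullbackFamily, map_sum, LinearMap.sum_apply, DivCat.tact_mul_word]
  rw [Finset.sum_ite_eq', Pi.single_apply]
  refine if_congr ?_ rfl rfl
  rw [Finset.mem_filter_univ, hg]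
  exact Subtype.ext_iff.symm.trans eq_comm

lemma exists_mul_gamCoeff_eq_single {i j : Fin d} {w : Words l} (hw : Equiv.swap i j • w = w) :
    ∃ x : (Gam k l).val (DivCat.free k d d), ∀ v, DivCat.tact (DivCat.mul k d)
      (DivCat.tmul (gamCoeff l _ x v) (DivCat.word k (Function.update id j i))) =
        (Pi.single w (DivCat.word k (Function.update id j i)) :
          Words l → (DivCat.free k d d).T) v := by
  refine ⟨ofInvariantFamily _ (permPi_pullbackFamily w), fun v => ?_⟩
  rw [gamCoeff_ofInvariantFamily]
  refine mul_pullbackFamily ?_ v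
  rw [Function.comp_update, Function.comp_id, Words.swap_smul_eq_iff.1 hw,
    Function.update_eq_self]

end Gam

end SPF

/-! ## Direct sums of presented functors -/

namespace SPF

section DirectSum

variable {ι Ω : Type} {Ωs : ι → Type} {V : DivCat k d}

/-- The part of an element of `k[Ω] ⊗ V^{⊗ d}` in one summand of `Ω`. -/
def restrict (e : (Σ i, Ωs i) ≃ Ω) (i : ι) : (Ω → V.T) →ₗ[k] (Ωs i → V.T) :=
  LinearMap.funLeft k V.T fun v => e ⟨i, v⟩

lemma restrict_single_same [DecidableEq Ω] [∀ i, DecidableEq (Ωs i)] (e : (Σ i, Ωs i) ≃ Ω)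
    (i : ι) (v : Ωs i) (t : V.T) : restrict e i (Pi.single (e ⟨i, v⟩) t) = Pi.single v t := by
  ext v' : 1
  have h : e ⟨i, v'⟩ = e ⟨i, v⟩ ↔ v' = v := e.injective.eq_iff.trans sigma_mk_injective.eq_iff
  simp only [restrict, LinearMap.funLeft_apply, Pi.single_apply, h]

lemma restrict_single_of_ne [DecidableEq Ω] (e : (Σ i, Ωs i) ≃ Ω) {i j : ι} (hij : i ≠ j)
    (v : Ωs i) (t : V.T) : restrict e j (Pi.single (e ⟨i, v⟩) t) = 0 := by
  ext v' : 1
  have h : e ⟨j, v'⟩ ≠ e ⟨i, v⟩ := fun h => hij (congrArg Sigma.fst (e.injective h)).symm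
  rw [restrict, LinearMap.funLeft_apply, Pi.single_eq_of_ne h, Pi.zero_apply]

section Extend

variable [∀ i, Fintype (Ωs i)] [DecidableEq Ω] [∀ i, DecidableEq (Ωs i)] (e : (Σ i, Ωs i) ≃ Ω)

/-- The extension by zero from one summand of `Ω`. -/
def extend (i : ι) : (Ωs i → V.T) →ₗ[k] (Ω → V.T) :=
  LinearMap.lsum k (fun _ => V.T) k fun v => LinearMap.single k (fun _ => V.T) (e ⟨i, v⟩)

lemma extend_single (i : ι) (v : Ωs i) (t : V.T) :
    extend e i (Pi.single v t) = Pi.single (e ⟨i, v⟩) t :=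
  LinearMap.lsum_piSingle ..

lemma sum_extend_restrict [Fintype ι] (z : Ω → V.T) :
    ∑ i, extend e i (restrict e i z) = z := by
  have := Fintype.ofEquiv _ e
  conv_rhs => rw [← Finset.univ_sum_single z, ← e.sum_comp, Fintype.sum_sigma]
  simp only [extend, LinearMap.lsum_apply, LinearMap.sum_apply]
  rfl

lemma mem_iff_restrict_mem [Finite ι] {R : Submodule k (Ω → V.T)}
    {Rs : ∀ i, Submodule k (Ωs i → V.T)} (h_restrict : ∀ i, R ≤ (Rs i).comap (restrict e i))
    (h_extend : ∀ i, Rs i ≤ R.comap (extend e i)) {z : Ω → V.T} :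
    z ∈ R ↔ ∀ i, restrict e i z ∈ Rs i := by
  refine ⟨fun hz i => h_restrict i hz, fun hz => ?_⟩
  cases nonempty_fintype ι
  rw [← sum_extend_restrict e z]
  exact Submodule.sum_mem _ fun i _ => h_extend i (hz i)

end Extend

section Equivariant

variable [MulAction (Equiv.Perm (Fin d)) Ω] [∀ i, MulAction (Equiv.Perm (Fin d)) (Ωs i)]
  {e : (Σ i, Ωs i) ≃ Ω}

lemma charRel_le_comap_restrict
    (he : ∀ (σ : Equiv.Perm (Fin d)) i v, e ⟨i, σ • v⟩ = σ • e ⟨i, v⟩)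
    (ε : Equiv.Perm (Fin d) →* k) (i : ι) :
    charRel Ω ε V ≤ (charRel (Ωs i) ε V).comap (restrict e i) := by
  have h_permPi : ∀ σ (y : Ω → V.T), restrict e i (permPi σ y) = permPi σ (restrict e i y) :=
    fun σ y => funext fun v => congrArg (fun w => perm k σ (y w)) (he σ⁻¹ i v).symm
  refine Submodule.span_le.2 ?_
  rintro _ ⟨σ, y, rfl⟩
  rw [SetLike.mem_coe, Submodule.mem_comap, map_sub, map_smul, h_permPi]
  exact permPi_sub_mem_charRel σ _

lemma diagRel_le_comap_restrict [DecidableEq Ω] [∀ i, DecidableEq (Ωs i)]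
    (he : ∀ (σ : Equiv.Perm (Fin d)) i v, e ⟨i, σ • v⟩ = σ • e ⟨i, v⟩) (i : ι) :
    diagRel Ω V ≤ (diagRel (Ωs i) V).comap (restrict e i) := by
  refine Submodule.span_le.2 ?_
  rintro _ ⟨a, b, w, x, hab, hw, hx, rfl⟩
  obtain ⟨⟨j, v⟩, rfl⟩ := e.surjective w
  rw [SetLike.mem_coe, Submodule.mem_comap]
  rcases eq_or_ne j i with rfl | hij
  · rw [← he, e.apply_eq_iff_eq] at hw
    rw [restrict_single_same]
    exact Submodule.subset_span ⟨a, b, v, x, hab, eq_of_heq (Sigma.mk.inj hw).2, hx, rfl⟩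
  · rw [restrict_single_of_ne e hij]
    exact zero_mem _

lemma charRel_le_comap_extend [∀ i, Fintype (Ωs i)] [DecidableEq Ω] [∀ i, DecidableEq (Ωs i)]
    (he : ∀ (σ : Equiv.Perm (Fin d)) i v, e ⟨i, σ • v⟩ = σ • e ⟨i, v⟩)
    (ε : Equiv.Perm (Fin d) →* k) (i : ι) :
    charRel (Ωs i) ε V ≤ (charRel Ω ε V).comap (extend e i) :=
  charRel_le_iff.2 fun σ v t => by
    rw [Submodule.mem_comap, map_sub, map_smul, extend_single, extend_single, he, ← permPi_single]
    exact permPi_sub_mem_charRel σ _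

lemma diagRel_le_comap_extend [∀ i, Fintype (Ωs i)] [DecidableEq Ω] [∀ i, DecidableEq (Ωs i)]
    (he : ∀ (σ : Equiv.Perm (Fin d)) i v, e ⟨i, σ • v⟩ = σ • e ⟨i, v⟩) (i : ι) :
    diagRel (Ωs i) V ≤ (diagRel Ω V).comap (extend e i) := by
  refine Submodule.span_le.2 ?_
  rintro _ ⟨a, b, v, x, hab, hv, hx, rfl⟩
  rw [SetLike.mem_coe, Submodule.mem_comap, extend_single]
  exact Submodule.subset_span ⟨a, b, _, x, hab, by rw [← he, hv], hx, rfl⟩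

variable [Finite ι] [∀ i, Finite (Ωs i)]

lemma mem_charRel_iff_restrict
    (he : ∀ (σ : Equiv.Perm (Fin d)) i v, e ⟨i, σ • v⟩ = σ • e ⟨i, v⟩)
    {ε : Equiv.Perm (Fin d) →* k} {z : Ω → V.T} :
    z ∈ charRel Ω ε V ↔ ∀ i, restrict e i z ∈ charRel (Ωs i) ε V := by
  classical
  have (i : ι) := Fintype.ofFinite (Ωs i)
  exact mem_iff_restrict_mem e (charRel_le_comap_restrict he ε) (charRel_le_comap_extend he ε)

lemma mem_extRel_iff_restrict [DecidableEq Ω] [∀ i, DecidableEq (Ωs i)]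
    (he : ∀ (σ : Equiv.Perm (Fin d)) i v, e ⟨i, σ • v⟩ = σ • e ⟨i, v⟩) {z : Ω → V.T} :
    z ∈ extRel Ω V ↔ ∀ i, restrict e i z ∈ extRel (Ωs i) V := by
  have (i : ι) := Fintype.ofFinite (Ωs i)
  exact mem_iff_restrict_mem e
    (fun i => sup_le ((charRel_le_comap_restrict he _ i).trans (Submodule.comap_mono le_sup_left))
      ((diagRel_le_comap_restrict he i).trans (Submodule.comap_mono le_sup_right)))
    (fun i => sup_le ((charRel_le_comap_extend he _ i).trans (Submodule.comap_mono le_sup_left))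
      ((diagRel_le_comap_extend he i).trans (Submodule.comap_mono le_sup_right)))

end Equivariant

section SumPresentation

variable [Fintype ι] {Y : ι → SPF k d} {Rs : ∀ (i : ι) (V : DivCat k d), Submodule k (Ωs i → V.T)}
  (e : (Σ i, Ωs i) ≃ Ω) (P : ∀ i, Presentation (Y i) (Ωs i) (Rs i))

/-- The quotient map onto a direct sum of presented functors. -/
def sumProj (V : DivCat k d) : (Ω → V.T) →ₗ[k] DirectSum ι fun i => (Y i).val V :=
  (DirectSum.linearEquivFunOnFintype k ι fun i => (Y i).val V).symm.toLinearMap ∘ₗ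
    LinearMap.pi fun i => (P i).proj V ∘ₗ restrict e i

lemma sumProj_apply (z : Ω → V.T) (i : ι) :
    sumProj e P V z i = (P i).proj V (restrict e i z) :=
  congrFun ((DirectSum.linearEquivFunOnFintype k ι fun i => (Y i).val V).apply_symm_apply
    (LinearMap.pi (fun i => (P i).proj V ∘ₗ restrict e i) z)) i

lemma sumProj_surjective : Function.Surjective (sumProj e P V) := fun y => by
  choose z hz using fun i => (P i).surjective V (y i)
  refine ⟨fun w => z (e.symm w).1 (e.symm w).2, DFinsupp.ext fun i => ?_⟩
  have h : restrict e i (fun w => z (e.symm w).1 (e.symm w).2) = z i := funext fun v =>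
    congrArg (fun p : Σ i, Ωs i => z p.1 p.2) (e.symm_apply_apply ⟨i, v⟩)
  exact (sumProj_apply e P _ i).trans ((congrArg _ h).trans (hz i))

lemma sumProj_eq_zero_iff {z : Ω → V.T} :
    sumProj e P V z = 0 ↔ ∀ i, restrict e i z ∈ Rs i V :=
  DFinsupp.ext_iff.trans <| forall_congr' fun i =>
    (Eq.congr_left (sumProj_apply e P z i)).trans (P i).proj_eq_zero

lemma act_sumProj {W : DivCat k d} (f : V ⟶ W) (z : Ω → V.T) :
    (directSum Y).act f (sumProj e P V z) = sumProj e P W (actPi Ω f z) :=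
  DFinsupp.ext fun i => (congrArg ((Y i).act f) (sumProj_apply e P z i)).trans <|
    ((P i).act_proj f _).trans (sumProj_apply e P (actPi Ω f z) i).symm

/-- The presentation of a direct sum of presented functors by the disjoint union of their
index sets. -/
def sumPresentation {R : ∀ V : DivCat k d, Submodule k (Ω → V.T)}
    (hR : ∀ {V} {z : Ω → V.T}, z ∈ R V ↔ ∀ i, restrict e i z ∈ Rs i V) :
    Presentation (directSum Y) Ω R where
  proj := sumProj e P
  surjective _ := sumProj_surjective e P
  proj_eq_zero := (sumProj_eq_zero_iff e P).trans hR.symm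
  act_proj := act_sumProj e P

end SumPresentation

end DirectSum

end SPF

/-! ## Internal tensor products -/

namespace SPF

section InternalTensor

variable {X Y Z : SPF k d} {Ω Ω' : Type} [Finite Ω']
  [MulAction (Equiv.Perm (Fin d)) Ω] [MulAction (Equiv.Perm (Fin d)) Ω']
  {ε ε' η : Equiv.Perm (Fin d) →* k}

lemma Coefficients.nonempty_internalTensor_iso_of_charRel [Fintype Ω] [DecidableEq Ω]
    (D : Coefficients X Ω ε)
    (P : Presentation Y Ω' (charRel Ω' ε')) (Q : Presentation Z (Ω × Ω') (charRel (Ω × Ω') η))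
    (h : ε * ε' = η) : Nonempty (internalTensor X Y ≅ Z) := by
  classical
  subst h
  exact D.nonempty_internalTensor_iso P Q
    (fun _ _ x _ hy => outer_mem_charRel (fun σ => D.permPi_coeff σ x) hy)
    (D.charRel_le_pairSpan fun _ => le_rfl)

variable [DecidableEq Ω']

lemma Coefficients.nonempty_internalTensor_iso_of_extRel [Fintype Ω] [DecidableEq Ω]
    (D : Coefficients X Ω 1)
    (hD : ∀ (i j : Fin d) (w : Ω), Equiv.swap i j • w = w →
      ∃ x : X.val (DivCat.free k d d), ∀ v, DivCat.tact (DivCat.mul k d)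
        (DivCat.tmul (D.coeff _ x v) (DivCat.word k (Function.update id j i))) =
          (Pi.single w (DivCat.word k (Function.update id j i)) : Ω → (DivCat.free k d d).T) v)
    (P : Presentation Y Ω' (extRel Ω')) (Q : Presentation Z (Ω × Ω') (extRel (Ω × Ω'))) :
    Nonempty (internalTensor X Y ≅ Z) := by
  refine D.nonempty_internalTensor_iso P Q (fun V W x y hy => ?_) fun U => sup_le ?_ ?_
  · refine outer_mem_extRel (fun σ => ?_) hy
    rw [D.permPi_coeff, MonoidHom.one_apply, one_smul]
  · simpa only [one_mul] using D.charRel_le_pairSpan (R := extRel Ω') (fun _ => le_sup_left) U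
  · exact D.diagRel_le_pairSpan (fun _ => le_sup_right) hD U

lemma Presentation.nonempty_internalTensor_iso_of_extRel [Finite Ω]
    {R : ∀ V : DivCat k d, Submodule k (Ω → V.T)} (P : Presentation X Ω R)
    (hR : ∀ V, charRel Ω ε V ≤ R V) (havg : ∀ V, R V ≤ LinearMap.ker (averaging ε))
    (P' : Presentation Y Ω' (extRel Ω')) (Q : Presentation Z (Ω × Ω') (charRel (Ω × Ω') η))
    (h : ε * sgnChar k d = η) : Nonempty (internalTensor X Y ≅ Z) := by
  classical
  cases nonempty_fintype Ω
  subst h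
  refine (Coefficients.ofPresentation P hR havg).nonempty_internalTensor_iso P' Q
    (fun V W x y hy => ?_) (Coefficients.charRel_le_pairSpan _ fun _ => le_sup_left)
  obtain ⟨z, rfl⟩ := P.surjective V x
  rw [Coefficients.ofPresentation_coeff]
  exact outer_averaging_mem_charRel z hy

end InternalTensor

section Powers

variable {m n : ℕ} (lam : Weight m d) (mu : Weight n d)

instance : Fintype (Weight.Matrices mu lam) := Fintype.ofFinite _

/-- The presentation of a direct sum of symmetric powers by pairs of words. -/
def symmSumPresentation (k : Type u) [CommRing k] :
    Presentation (directSum fun nu : Weight.Matrices mu lam => Symm k (Weight.ofMatrix nu))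
      (Words lam × Words mu) (charRel _ (1 : Equiv.Perm (Fin d) →* k)) :=
  sumPresentation (splitEquiv lam mu) (fun _ => symmPresentation k _)
    (mem_charRel_iff_restrict splitEquiv_smul)

/-- The presentation of a direct sum of exterior powers by pairs of words. -/
def wedgeSumPresentation (k : Type u) [CommRing k] :
    Presentation (directSum fun nu : Weight.Matrices mu lam => Wedge k (Weight.ofMatrix nu))
      (Words lam × Words mu) (extRel (k := k) (d := d) _) :=
  sumPresentation (splitEquiv lam mu) (fun _ => wedgePresentation k _)
    (mem_extRel_iff_restrict splitEquiv_smul)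

/-- The coefficients of `Sym^l`. -/
def symmCoefficients (k : Type u) [CommRing k] : Coefficients (Symm k lam) (Words lam) 1 :=
  .ofPresentation (symmPresentation k lam) (fun _ => le_rfl) fun _ _ => averaging_of_mem_charRel

lemma nonempty_gam_wedge : Nonempty (internalTensor (Gam k lam) (Wedge k mu) ≅
    directSum fun nu : Weight.Matrices mu lam => Wedge k (Weight.ofMatrix nu)) :=
  (gamCoefficients k lam).nonempty_internalTensor_iso_of_extRel
    (fun _ _ _ => exists_mul_gamCoeff_eq_single) (wedgePresentation k mu)
    (wedgeSumPresentation lam mu k)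

lemma nonempty_gam_symm : Nonempty (internalTensor (Gam k lam) (Symm k mu) ≅
    directSum fun nu : Weight.Matrices mu lam => Symm k (Weight.ofMatrix nu)) :=
  (gamCoefficients k lam).nonempty_internalTensor_iso_of_charRel (symmPresentation k mu)
    (symmSumPresentation lam mu k) (one_mul 1)

lemma nonempty_symm_symm : Nonempty (internalTensor (Symm k lam) (Symm k mu) ≅
    directSum fun nu : Weight.Matrices mu lam => Symm k (Weight.ofMatrix nu)) :=
  (symmCoefficients lam k).nonempty_internalTensor_iso_of_charRel (symmPresentation k mu)
    (symmSumPresentation lam mu k) (one_mul 1)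

lemma nonempty_wedge_wedge : Nonempty (internalTensor (Wedge k lam) (Wedge k mu) ≅
    directSum fun nu : Weight.Matrices mu lam => Symm k (Weight.ofMatrix nu)) :=
  (wedgePresentation k lam).nonempty_internalTensor_iso_of_extRel (fun _ => le_sup_left)
    (fun _ _ => averaging_of_mem_extRel) (wedgePresentation k mu) (symmSumPresentation lam mu k)
    sgnChar_mul_self

lemma nonempty_symm_wedge_of_charRel {Z : SPF k d}
    (Q : Presentation Z (Words lam × Words mu) (charRel _ (sgnChar k d))) :
    Nonempty (internalTensor (Symm k lam) (Wedge k mu) ≅ Z) :=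
  (symmPresentation k lam).nonempty_internalTensor_iso_of_extRel (fun _ => le_rfl)
    (fun _ _ => averaging_of_mem_charRel) (wedgePresentation k mu) Q (one_mul _)

lemma nonempty_symm_wedge_of_isUnit (h2 : IsUnit (2 : k)) :
    Nonempty (internalTensor (Symm k lam) (Wedge k mu) ≅
      directSum fun nu : Weight.Matrices mu lam => Wedge k (Weight.ofMatrix nu)) := by
  have h : extRel (Words lam × Words mu) = charRel _ (sgnChar k d) :=
    funext fun _ => extRel_eq_charRel h2
  exact nonempty_symm_wedge_of_charRel lam mu (h ▸ wedgeSumPresentation lam mu k)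

lemma nonempty_symm_wedge_of_two_eq_zero (h2 : (2 : k) = 0) :
    Nonempty (internalTensor (Symm k lam) (Wedge k mu) ≅
      directSum fun nu : Weight.Matrices mu lam => Symm k (Weight.ofMatrix nu)) := by
  have Q := symmSumPresentation lam mu k
  rw [← sgnChar_eq_one h2] at Q
  exact nonempty_symm_wedge_of_charRel lam mu Q

end Powers

end SPF

/-! ## The tensor product of two permutation modules -/

section PermModule

variable {n : ℕ}

/-- The `S_d`-set `S_d / S_l` as the set of words of weight `l`. -/
def quotientYoungEquiv (l : Weight n d) : Equiv.Perm (Fin d) ⧸ l.young ≃ Words l :=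
  (Subgroup.quotientEquivOfEq (Subgroup.ext fun _ => smul_blockWord_eq_iff.symm :
    l.young = MulAction.stabilizer _ (blockWord l))).trans <|
  .ofBijective (MulAction.ofQuotientStabilizer _ (blockWord l))
    ⟨MulAction.injective_ofQuotientStabilizer _ _, fun w =>
      let ⟨σ, hσ⟩ := exists_smul_blockWord_eq w
      ⟨σ, hσ⟩⟩

lemma quotientYoungEquiv_smul (l : Weight n d) (σ : Equiv.Perm (Fin d))
    (q : Equiv.Perm (Fin d) ⧸ l.young) :
    quotientYoungEquiv l (σ • q) = σ • quotientYoungEquiv l q := by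
  obtain ⟨τ, rfl⟩ := QuotientGroup.mk_surjective q
  exact mul_smul σ τ (blockWord l)

/-- The basis of `M^l` that consists of the words of weight `l`. -/
def wordBasis (k : Type u) [CommRing k] (l : Weight n d) :
    Module.Basis (Words l) k (MonoidAlgebra k (Equiv.Perm (Fin d) ⧸ l.young)) :=
  (MonoidAlgebra.basis _ k).reindex (quotientYoungEquiv l)

lemma permModule_wordBasis (l : Weight n d) (σ : Equiv.Perm (Fin d)) (w : Words l) :
    permModule k l σ (wordBasis k l w) = wordBasis k l (σ • w) := by
  obtain ⟨q, rfl⟩ := (quotientYoungEquiv l).surjective w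
  rw [← quotientYoungEquiv_smul]
  simp only [wordBasis, Module.Basis.reindex_apply, Equiv.symm_apply_apply,
    MonoidAlgebra.basis_apply, Representation.ofMulAction_single]

lemma dfinsuppBasis_apply {ι : Type*} [DecidableEq ι] {Z M : ι → Type*}
    [∀ i, AddCommGroup (M i)] [∀ i, Module k (M i)] (b : ∀ i, Module.Basis (Z i) k (M i))
    (i : ι) (z : Z i) : DFinsupp.basis b ⟨i, z⟩ = DirectSum.lof k ι M i (b i z) := by
  change (DFinsupp.mapRange.linearEquiv fun i => (b i).repr).symm
    ((sigmaFinsuppLequivDFinsupp k).symm.symm (Finsupp.single ⟨i, z⟩ 1)) = _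
  rw [LinearEquiv.symm_apply_eq]
  refine (sigmaFinsuppEquivDFinsupp_single _ _).trans ?_
  refine Eq.trans ?_ (DFinsupp.mapRange_single (hf := fun i => map_zero (b i).repr)).symm
  rw [Module.Basis.repr_self]

lemma nonempty_tprod_equiv_directSum {G ι X Y : Type*} [Group G] {Z : ι → Type*}
    [SMul G X] [SMul G Y] [∀ i, SMul G (Z i)] {A B : Type*} {M : ι → Type*}
    [AddCommGroup A] [Module k A] [AddCommGroup B] [Module k B]
    [∀ i, AddCommGroup (M i)] [∀ i, Module k (M i)]
    {ρ : Representation k G A} {τ : Representation k G B} {π : ∀ i, Representation k G (M i)}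
    (a : Module.Basis X k A) (b : Module.Basis Y k B) (c : ∀ i, Module.Basis (Z i) k (M i))
    (ha : ∀ g x, ρ g (a x) = a (g • x)) (hb : ∀ g y, τ g (b y) = b (g • y))
    (hc : ∀ i g z, π i g (c i z) = c i (g • z)) (e : (Σ i, Z i) ≃ X × Y)
    (he : ∀ (g : G) i z, e ⟨i, g • z⟩ = g • e ⟨i, z⟩) :
    Nonempty ((ρ.tprod τ).Equiv (Representation.directSum π)) := by
  classical
  let E := (a.tensorProduct b).equiv (DFinsupp.basis c) e.symm
  have hE (i : ι) (z : Z i) :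
      E (a.tensorProduct b (e ⟨i, z⟩)) = DirectSum.lof k ι M i (c i z) := by
    rw [Module.Basis.equiv_apply, Equiv.symm_apply_apply, dfinsuppBasis_apply]
  have hab (g : G) (p : X × Y) :
      ρ.tprod τ g (a.tensorProduct b p) = a.tensorProduct b (g • p) := by
    simp only [Module.Basis.tensorProduct_apply', Representation.tprod_apply,
      TensorProduct.map_tmul, ha, hb, Prod.smul_fst, Prod.smul_snd]
  have hπ (g : G) (i : ι) (z : Z i) : Representation.directSum π g (DirectSum.lof k ι M i (c i z)) =
      DirectSum.lof k ι M i (c i (g • z)) :=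
    (DirectSum.lmap_lof ..).trans (congrArg _ (hc i g z))
  refine ⟨.mk E fun g => (a.tensorProduct b).ext fun p => ?_⟩
  obtain ⟨⟨i, z⟩, rfl⟩ := e.surjective p
  calc E (ρ.tprod τ g (a.tensorProduct b (e ⟨i, z⟩)))
      = DirectSum.lof k ι M i (c i (g • z)) := by rw [hab, ← he, hE]
    _ = Representation.directSum π g (E (a.tensorProduct b (e ⟨i, z⟩))) := by rw [hE, hπ]

lemma nonempty_permModule_tprod {m : ℕ} (lam : Weight m d) (mu : Weight n d) :
    Nonempty (((permModule k mu).tprod (permModule k lam)).Equiv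
      (Representation.directSum fun nu : Weight.Matrices mu lam =>
        permModule k (Weight.ofMatrix nu))) :=
  nonempty_tprod_equiv_directSum (wordBasis k mu) (wordBasis k lam)
    (fun nu => wordBasis k (Weight.ofMatrix nu)) (permModule_wordBasis mu)
    (permModule_wordBasis lam) (fun _ => permModule_wordBasis _)
    ((splitEquiv lam mu).trans (Equiv.prodComm _ _))
    fun σ A v => congrArg Prod.swap (splitEquiv_smul σ A v)

end PermModule

end

end StrictPoly

open StrictPoly StrictPoly.SPF in
theorem corollary3p13 {k : Type u} [CommRing k] {d m n : ℕ}
    (lam : Weight m d) (mu : Weight n d) :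
    Nonempty (internalTensor (Gam k lam) (Wedge k mu) ≅
      directSum fun nu : Weight.Matrices mu lam => Wedge k (Weight.ofMatrix nu)) ∧
    Nonempty (internalTensor (Gam k lam) (Symm k mu) ≅
      directSum fun nu : Weight.Matrices mu lam => Symm k (Weight.ofMatrix nu)) ∧
    Nonempty (internalTensor (Wedge k lam) (Wedge k mu) ≅
      directSum fun nu : Weight.Matrices mu lam => Symm k (Weight.ofMatrix nu)) ∧
    Nonempty (internalTensor (Symm k lam) (Symm k mu) ≅
      directSum fun nu : Weight.Matrices mu lam => Symm k (Weight.ofMatrix nu)) ∧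
    (IsUnit (2 : k) → Nonempty (internalTensor (Symm k lam) (Wedge k mu) ≅
      directSum fun nu : Weight.Matrices mu lam => Wedge k (Weight.ofMatrix nu))) ∧
    ((2 : k) = 0 → Nonempty (internalTensor (Symm k lam) (Wedge k mu) ≅
      directSum fun nu : Weight.Matrices mu lam => Symm k (Weight.ofMatrix nu))) ∧
    Nonempty (((permModule k mu).tprod (permModule k lam)).Equiv
      (Representation.directSum fun nu : Weight.Matrices mu lam =>
        permModule k (Weight.ofMatrix nu))) :=
  ⟨nonempty_gam_wedge lam mu, nonempty_gam_symm lam mu, nonempty_wedge_wedge lam mu,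
    nonempty_symm_symm lam mu, nonempty_symm_wedge_of_isUnit lam mu,
    nonempty_symm_wedge_of_two_eq_zero lam mu, nonempty_permModule_tprod lam mu⟩
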